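/- Let $(S,\Sigma,P)$ be a probability space that is \emph{adequate}: either $P$ is nonatomic (every $A\in\Sigma$ with $P(A)>0$ contains some $B\in\Sigma$ with $0<P(B)<P(A)$), or $\Sigma$ is generated by a finite partition of $S$ into events of equal probability. Let $\mathcal F$ be either the space $\mathcal L^\infty$ of almost surely bounded random variables $f:S\to\mathbb R$, or the space $\mathcal M^\infty$ of random variables with finite absolute moments of all orders. Convergence of sequences in $\mathcal F$ means convergence $\mathbb E[|f_n-f|^p]\to0$ for every integer $p\ge1$ if $\mathcal F=\mathcal M^\infty$, and bounded almost sure convergence ($f_n\to f$ a.s. and, for some $M\in\mathbb R$, $|f_n|\le M$ a.s. for all $n$) if $\mathcal F=\mathcal L^\infty$; continuity with respect to the latter is implied by continuity with respect to convergence of all moments. Write $f\overset{d}{=}g$ for equality in distribution. A \emph{risk preference} $\succsim$ is a transitive binary relation on $\mathcal F$ that is law invariant, i.e. $f\overset{d}{=}g$ implies $f\sim g$, where $f\sim g$ means $f\succsim g$ and $g\succsim f$, and $f\succ g$ means $f\succsim g$ and not $g\succsim f$. It is \emph{continuous} if $f_n\to f$, $g_n\to g$ and $f_n\succsim g_n$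 for all $n$ imply $f\succsim g$; \emph{monotone} if $w+\varepsilon\succ w$ for all $w\in\mathcal F$ and all real $\varepsilon>0$; \emph{secular} if for all $f,g\in\mathcal F$ there is $\rho\in\mathbb R$ with $g\sim f-\rho$. For a monotone and secular risk preference this $\rho$ is unique and is denoted $\rho(g,f)$. For $f,g\in\mathcal F$ write $f\ge_{\mathrm{cv}}g$ if $\mathbb E[\varphi(f)]\ge\mathbb E[\varphi(g)]$ (as elements of $[-\infty,\infty)$) for all concave $\varphi:\mathbb R\to\mathbb R$. For risk preferences $\succsim_{\mathrm A},\succsim_{\mathrm B}$, say that $\mathrm B$ is \emph{strongly more risk averse} than $\mathrm A$ (in the sense of Ross) if for all $f,g\in\mathcal F$ and $\rho_{\mathrm A},\rho_{\mathrm B}\in\mathbb R$, the conditions $f\ge_{\mathrm{cv}}g$, $g\sim_{\mathrm A}f-\rho_{\mathrm A}$ and $g\sim_{\mathrm B}f-\rho_{\mathrm B}$ imply $\rho_{\mathrm B}\ge\rho_{\mathrm A}$. For a risk $w\in\mathcal F$, a random payoff $f\in\mathcal F$ is - a \emph{proportional insurance}, $f\in\mathcal I^{\mathrm{pr}}(w)$,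 if $f=-(1-\varepsilon)w-\pi$ for some $\pi\in\mathbb R$ and $\varepsilon\in[0,1)$; - a \emph{deductible-limit insurance}, $f\in\mathcal I^{\mathrm{dl}}(w)$, if $f=\min\{(-w-\delta)^+,\lambda\}-\pi$ for some $\pi,\delta\in\mathbb R$ and $\lambda\in[0,\infty)$; - an \emph{indemnity-schedule insurance}, $f\in\mathcal I^{\mathrm{is}}(w)$, if $f=I(-w)$ for some (weakly) increasing real-valued map $I$ on the image of $-w$; - a \emph{contingency-schedule insurance}, $f\in\mathcal I^{\mathrm{cs}}(w)$, if for $P\times P$-almost all $(s,s')$, $-w(s)>-w(s')$ implies $f(s)\ge f(s')$. Say that $f$ is a \emph{better hedge} for $w$ than $g$, $f\trianglerighteq_w g$, if $f\overset{d}{=}g$ and $P(f\le\tau\mid w\le\lambda)\le P(g\le\tau\mid w\le\lambda)$ for all $\tau,\lambda\in\mathbb R$ with $P(w\le\lambda)>0$. For monotone and secular risk preferences $\succsim_{\mathrm A},\succsim_{\mathrm B}$, $\mathrm B$ is \emph{more propense} than $\mathrm A$ to proportional (deductible-limit, indemnity-schedule, contingency-schedule) insurance if, for all $w,f,g\in\mathcal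 F$ with $g\overset{d}{=}f$, $f\in\mathcal I(w)$ implies $$\rho_{\mathrm B}(w+g,w+f)\ge\rho_{\mathrm A}(w+g,w+f),$$ where $\mathcal I$ is $\mathcal I^{\mathrm{pr}}$ ($\mathcal I^{\mathrm{dl}}$, $\mathcal I^{\mathrm{is}}$, $\mathcal I^{\mathrm{cs}}$); and $\mathrm B$ is \emph{more propense to hedging} than $\mathrm A$ if, for all $w,f,g\in\mathcal F$ with $g\overset{d}{=}f$, $f\trianglerighteq_w g$ implies the same inequality. **Theorem.** Let $\succsim_{\mathrm A}$ and $\succsim_{\mathrm B}$ be two continuous, monotone and secular risk preferences on $\mathcal F$. The following are equivalent: (i) $\mathrm B$ is strongly more risk averse than $\mathrm A$; (ii) $\mathrm B$ is more propense to proportional insurance than $\mathrm A$; (iii) $\mathrm B$ is more propense to deductible-limit insurance than $\mathrm A$; (iv) $\mathrm B$ is more propense to indemnity-schedule insurance than $\mathrm A$; (v) $\mathrm B$ is more propense to contingency-schedule insurance than $\mathrm A$; (vi) $\mathrm B$ is more propense to hedging than $\mathrm A$. -/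

import Mathlib

open MeasureTheory ProbabilityTheory Filter Topology
open scoped ENNReal

namespace InsuranceRisk

/-- A nonatomic measure: every event of positive probability contains an event of strictly smaller
positive probability. -/
def IsNonatomic {S : Type*} [MeasurableSpace S] (P : Measure S) : Prop :=
  ∀ A : Set S, MeasurableSet A → 0 < P A →
    ∃ B : Set S, B ⊆ A ∧ MeasurableSet B ∧ 0 < P B ∧ P B < P A

/-- The measure is uniform on a finite partition that generates the sigma-algebra. -/
def IsUniformOnFinitePartition {S : Type*} [mS : MeasurableSpace S] (P : Measure S) : Prop :=
  ∃ (n : ℕ) (C : Fin n → Set S),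
    Pairwise (fun i j => Disjoint (C i) (C j)) ∧ (⋃ i, C i) = Set.univ ∧
    mS = MeasurableSpace.generateFrom (Set.range C) ∧
    ∀ i, P (C i) = (n : ℝ≥0∞)⁻¹

/-- Adequate (probability) measures. -/
def IsAdequate {S : Type*} [MeasurableSpace S] (P : Measure S) : Prop :=
  IsNonatomic P ∨ IsUniformOnFinitePartition P

/-- The two possible spaces of random payoffs: almost surely bounded random variables, or random
variables with finite moments of all orders. -/
inductive PayoffClass where
  | bounded
  | allMoments

/-- The integrability requirement of each class. -/
def PayoffClass.Admits {S : Type*} [MeasurableSpace S] (k : PayoffClass) (P : Measure S)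
    (f : S → ℝ) : Prop :=
  match k with
  | .bounded => MemLp f ∞ P
  | .allMoments => ∀ p : ℕ, MemLp f (p : ℝ≥0∞) P

/-- The vector space of random payoffs. Its elements are genuine measurable functions, not
equivalence classes. -/
def payoffSpace {S : Type*} [MeasurableSpace S] (P : Measure S) (k : PayoffClass) :
    Submodule ℝ (S → ℝ) where
  carrier := {f | Measurable f ∧ k.Admits P f}
  add_mem' := by
    rintro f g ⟨hf, hf'⟩ ⟨hg, hg'⟩
    refine ⟨hf.add hg, ?_⟩
    cases k with
    | bounded => exact MemLp.add (p := ∞) hf' hg'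
    | allMoments => exact fun p => (hf' p).add (hg' p)
  zero_mem' := by
    refine ⟨measurable_zero, ?_⟩
    cases k with
    | bounded => exact MemLp.zero (p := ∞)
    | allMoments => exact fun p => MemLp.zero
  smul_mem' := by
    rintro c f ⟨hf, hf'⟩
    refine ⟨hf.const_smul c, ?_⟩
    cases k with
    | bounded => exact MemLp.const_smul (p := ∞) hf' c
    | allMoments => exact fun p => (hf' p).const_smul c

/-- Random payoffs. -/
abbrev Payoff {S : Type*} [MeasurableSpace S] (P : Measure S) (k : PayoffClass) : Type _ :=
  ↥(payoffSpace P k)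

section

variable {S : Type*} [MeasurableSpace S] {P : Measure S} [IsProbabilityMeasure P]
  {k : PayoffClass}

/-- The sure payoff with value `c`. -/
def sure (P : Measure S) [IsProbabilityMeasure P] (k : PayoffClass) (c : ℝ) : Payoff P k :=
  ⟨fun _ => c, measurable_const, by
    cases k with
    | bounded => exact memLp_const (p := ∞) c
    | allMoments => exact fun p => memLp_const c⟩

/-- Equality in distribution. -/
def EqDist (f g : Payoff P k) : Prop :=
  P.map (f : S → ℝ) = P.map (g : S → ℝ)

/-- Convergence of sequences of random payoffs. On the space of random variables with all moments:
convergence of all absolute moments of the difference. On the space of bounded random variables: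
bounded almost sure convergence. -/
def Converges (f : ℕ → Payoff P k) (l : Payoff P k) : Prop :=
  match k with
  | .bounded =>
      (∃ M : ℝ, ∀ n, ∀ᵐ s ∂P, |(f n : S → ℝ) s| ≤ M) ∧
        ∀ᵐ s ∂P, Tendsto (fun n => (f n : S → ℝ) s) atTop (𝓝 ((l : S → ℝ) s))
  | .allMoments => ∀ p : ℕ, 1 ≤ p →
      Tendsto (fun n => ∫ s, |(f n : S → ℝ) s - (l : S → ℝ) s| ^ p ∂P) atTop (𝓝 0)

/-- `Converges` implies, on either space, convergence of all absolute moments of the difference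
to zero. Hence continuity with respect to the latter implies continuity with respect to
`Converges`. -/
theorem Converges.tendsto_moment {f : ℕ → Payoff P k} {l : Payoff P k} (h : Converges f l)
    {p : ℕ} (hp : 1 ≤ p) :
    Tendsto (fun n => ∫ s, |(f n : S → ℝ) s - (l : S → ℝ) s| ^ p ∂P) atTop (𝓝 0) := by
  cases k with
  | allMoments => exact h p hp
  | bounded =>
    obtain ⟨⟨M, hM⟩, hlim⟩ := h
    have hM' : ∀ᵐ s ∂P, ∀ n, |(f n : S → ℝ) s| ≤ M := ae_all_iff.2 hM
    have key : Tendsto (fun n => ∫ s, |(f n : S → ℝ) s - (l : S → ℝ) s| ^ p ∂P) atTop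
        (𝓝 (∫ _, (0 : ℝ) ∂P)) := by
      refine tendsto_integral_of_dominated_convergence (fun _ => (M + M) ^ p) ?_
        (integrable_const _) ?_ ?_
      · intro n
        have h1 : Measurable (f n : S → ℝ) := (f n).2.1
        have h2 : Measurable (l : S → ℝ) := l.2.1
        exact (((h1.sub h2).abs).pow_const p).aestronglyMeasurable
      · intro n
        filter_upwards [hM', hlim] with s hs hl
        have hl' : |(l : S → ℝ) s| ≤ M := le_of_tendsto hl.abs (Eventually.of_forall hs)
        have h3 : |(f n : S → ℝ) s - (l : S → ℝ) s| ≤ M + M :=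
          (abs_sub _ _).trans (add_le_add (hs n) hl')
        rw [Real.norm_of_nonneg (by positivity)]
        gcongr
      · filter_upwards [hlim] with s hl
        have h4 : Tendsto (fun n => |(f n : S → ℝ) s - (l : S → ℝ) s| ^ p) atTop
            (𝓝 (|(l : S → ℝ) s - (l : S → ℝ) s| ^ p)) := ((hl.sub_const _).abs).pow p
        have h5 : p ≠ 0 := by omega
        simpa [h5] using h4
    simpa using key

/-- The expectation of a random variable `X` whose positive part has finite expectation, as an
extended real in `[-∞, ∞)`: expected positive part minus expected negative part. -/
noncomputable def extExpectation (P : Measure S) (X : S → ℝ) : EReal :=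
  ((∫⁻ s, ENNReal.ofReal (X s) ∂P : ℝ≥0∞) : EReal) -
    ((∫⁻ s, ENNReal.ofReal (-X s) ∂P : ℝ≥0∞) : EReal)

/-- The concave order, `f` being less risky than `g`. For concave `φ` and integrable `f` the
positive part of `φ ∘ f` is integrable, so that both expectations are well defined in
`[-∞, ∞)`. -/
def ConcaveGE (f g : Payoff P k) : Prop :=
  ∀ φ : ℝ → ℝ, ConcaveOn ℝ Set.univ φ →
    extExpectation P (fun s => φ ((g : S → ℝ) s)) ≤ extExpectation P (fun s => φ ((f : S → ℝ) s))

/-- `f` is a better hedge for `w` than `g`. If `{w ≤ lam}` has probability zero, `cond` gives `0`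
on both sides, so that such `lam` impose no condition. -/
def BetterHedge (w f g : Payoff P k) : Prop :=
  EqDist f g ∧ ∀ tau lam : ℝ,
    P[{s | (f : S → ℝ) s ≤ tau} | {s | (w : S → ℝ) s ≤ lam}] ≤
      P[{s | (g : S → ℝ) s ≤ tau} | {s | (w : S → ℝ) s ≤ lam}]

/-- Proportional insurances for `w`. -/
def proportionalInsurance (w : Payoff P k) : Set (Payoff P k) :=
  {f | ∃ premium excess : ℝ, 0 ≤ excess ∧ excess < 1 ∧
    ∀ s, (f : S → ℝ) s = -((1 - excess) * (w : S → ℝ) s) - premium}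

/-- Deductible-limit insurances for `w`. -/
def deductibleLimitInsurance (w : Payoff P k) : Set (Payoff P k) :=
  {f | ∃ premium deductible limit : ℝ, 0 ≤ limit ∧
    ∀ s, (f : S → ℝ) s = min (max (-(w : S → ℝ) s - deductible) 0) limit - premium}

/-- Indemnity-schedule insurances for `w`: increasing functions of the loss `-w`. Only the values
of `I` on the image of `-w` matter. -/
def indemnityScheduleInsurance (w : Payoff P k) : Set (Payoff P k) :=
  {f | ∃ I : ℝ → ℝ, MonotoneOn I (Set.range fun s => -(w : S → ℝ) s) ∧
    ∀ s, (f : S → ℝ) s = I (-(w : S → ℝ) s)}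

/-- Contingency-schedule insurances for `w`. -/
def contingencyScheduleInsurance (w : Payoff P k) : Set (Payoff P k) :=
  {f | ∀ᵐ z ∂(P.prod P), -(w : S → ℝ) z.1 > -(w : S → ℝ) z.2 →
    (f : S → ℝ) z.1 ≥ (f : S → ℝ) z.2}

end

/-- A risk preference: a transitive and law invariant binary relation on random payoffs.
`prefers f g` reads `f` is (weakly) preferred to `g`. -/
structure RiskPreference {S : Type*} [MeasurableSpace S] (P : Measure S) (k : PayoffClass) where
  prefers : Payoff P k → Payoff P k → Prop
  trans : ∀ f g h, prefers f g → prefers g h → prefers f h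
  law_invariant : ∀ f g, EqDist f g → prefers f g ∧ prefers g f

namespace RiskPreference

variable {S : Type*} [MeasurableSpace S] {P : Measure S} [IsProbabilityMeasure P]
  {k : PayoffClass}

/-- Indifference. -/
def Indiff (R : RiskPreference P k) (f g : Payoff P k) : Prop :=
  R.prefers f g ∧ R.prefers g f

/-- Strict preference. -/
def Strict (R : RiskPreference P k) (f g : Payoff P k) : Prop :=
  R.prefers f g ∧ ¬ R.prefers g f

/-- Continuity of a risk preference. -/
def IsContinuous (R : RiskPreference P k) : Prop :=
  ∀ (f g : ℕ → Payoff P k) (f' g' : Payoff P k), Converges f f' → Converges g g' →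
    (∀ n, R.prefers (f n) (g n)) → R.prefers f' g'

/-- Monotonicity: adding a sure positive amount is strictly preferred. -/
def IsMonotone (R : RiskPreference P k) : Prop :=
  ∀ (w : Payoff P k) (ε : ℝ), 0 < ε → R.Strict (w + sure P k ε) w

/-- Secularity: every risk has its price. -/
def IsSecular (R : RiskPreference P k) : Prop :=
  ∀ f g : Payoff P k, ∃ ρ : ℝ, R.Indiff g (f - sure P k ρ)

/-- The sure amount `ρ(g, f)` such that `g` is indifferent to `f - ρ(g, f)`. It exists by
secularity, and it is unique under monotonicity (`price_eq` below). -/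
noncomputable def price (R : RiskPreference P k) (hR : R.IsSecular) (g f : Payoff P k) : ℝ :=
  (hR f g).choose

theorem price_spec (R : RiskPreference P k) (hR : R.IsSecular) (g f : Payoff P k) :
    R.Indiff g (f - sure P k (R.price hR g f)) :=
  (hR f g).choose_spec

theorem indiff_unique (R : RiskPreference P k) (hm : R.IsMonotone) {g f : Payoff P k} {a b : ℝ}
    (ha : R.Indiff g (f - sure P k a)) (hb : R.Indiff g (f - sure P k b)) : a = b := by
  have key : ∀ c d : ℝ, R.Indiff g (f - sure P k c) → R.Indiff g (f - sure P k d) → ¬ c < d := by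
    intro c d hc hd hlt
    have h := (hm (f - sure P k d) (d - c) (sub_pos.2 hlt)).2
    have e : f - sure P k d + sure P k (d - c) = f - sure P k c := by
      ext s
      simp [sure]
    rw [e] at h
    exact h (R.trans _ _ _ hd.2 hc.1)
  exact le_antisymm (not_lt.1 (key b a hb ha)) (not_lt.1 (key a b ha hb))

theorem price_eq (R : RiskPreference P k) (hm : R.IsMonotone) (hR : R.IsSecular)
    {g f : Payoff P k} {r : ℝ} (h : R.Indiff g (f - sure P k r)) : R.price hR g f = r :=
  R.indiff_unique hm (R.price_spec hR g f) h

/-- `B` is strongly more risk averse than `A`, in the sense of Ross. -/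
def StronglyMoreRiskAverse (B A : RiskPreference P k) : Prop :=
  ∀ (f g : Payoff P k) (ρA ρB : ℝ), ConcaveGE f g →
    A.Indiff g (f - sure P k ρA) → B.Indiff g (f - sure P k ρB) → ρB ≥ ρA

/-- `B` is more propense than `A` to the kind of insurance described by `I`, where `I w` is the set
of insurances of that kind for the risk `w`. -/
def MorePropenseToInsurance (B A : RiskPreference P k) (hB : B.IsSecular) (hA : A.IsSecular)
    (I : Payoff P k → Set (Payoff P k)) : Prop :=
  ∀ w f g : Payoff P k, EqDist g f → f ∈ I w →
    B.price hB (w + g) (w + f) ≥ A.price hA (w + g) (w + f)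

/-- `B` is more propense to hedging than `A`. -/
def MorePropenseToHedging (B A : RiskPreference P k) (hB : B.IsSecular) (hA : A.IsSecular) :
    Prop :=
  ∀ w f g : Payoff P k, EqDist g f → BetterHedge w f g →
    B.price hB (w + g) (w + f) ≥ A.price hA (w + g) (w + f)

end RiskPreference

end InsuranceRisk

set_option linter.unusedSectionVars false

/-! From (i) to (vi): by Fubini, the expectation of `(c - w - f)⁺` is the integral over `l` of `P(w
≤ l, f ≤ c - l)`. So if `f` is a better hedge for `w` than `g`, then `w + f` has smaller stop-loss
values than `w + g`, and the same mean. A convex function is an affine function plus a mixture of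
stop-loss payoffs, so this is already dominance in the concave order (`BetterHedge.concaveGE`). A
contingency schedule is a better hedge than any payoff of the same law
(`betterHedge_of_contingencySchedule`), and it is the widest of the four insurance classes, which
gives (v), (iv), (iii) and (ii).

The way back starts from either of the two narrow classes. On equally likely cells let `g` be the
insurance `f` with its values on two cells `i`, `j` swapped. Going from `w + f` to `w + g` then
moves the amount `f i - f j` from cell `i` to cell `j`. With `w = x - f` and a suitable `f`, every
transfer from a poorer to a richer cell arises this way (`TransfersRegressive`). As in the
Hardy–Littlewood–Pólya theorem, finitely many such transfers produce every vector that is riskier in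
the concave order (`TransfersRegressive.transfersRanking_of_prefix`). This settles finite spaces. A
nonatomic space carries a uniform variable, along which payoffs are rearranged by their quantile
functions and averaged over ever finer equal cells; continuity then gives the general case
(`TransfersRegressive.transfersRanking_uniform`).

Chaining transfers needs a comparison that composes. Preferences need not be translation invariant,
so prices do not simply add up; `TransfersRanking`, which quantifies over all translates, is
transitive, closed under limits and depends only on distributions. -/

namespace InsuranceRisk

/-! ### Convergence and equality in distribution of payoffs. -/

section Payoffs

variable {S : Type*} [MeasurableSpace S] {P : Measure S} [IsProbabilityMeasure P]
  {k : PayoffClass}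

@[simp] theorem sure_apply (c : ℝ) (s : S) : (sure P k c : S → ℝ) s = c := rfl

theorem sure_add (c d : ℝ) : sure P k (c + d) = sure P k c + sure P k d := rfl

theorem sure_zero : sure P k 0 = 0 := rfl

theorem sure_neg (c : ℝ) : sure P k (-c) = -sure P k c := by
  ext s
  simp

theorem Converges.const (f : Payoff P k) (hf : k = .bounded → ∃ M : ℝ, ∀ᵐ s ∂P, |(f : S → ℝ) s| ≤ M) :
    Converges (fun _ => f) f := by
  cases k with
  | bounded =>
    obtain ⟨M, hM⟩ := hf rfl
    exact ⟨⟨M, fun _ => hM⟩, ae_of_all _ fun s => tendsto_const_nhds⟩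
  | allMoments =>
    intro p hp
    have : p ≠ 0 := by omega
    simp [this]

theorem ae_abs_le_of_memLp_top {f : S → ℝ} (hf : MemLp f ∞ P) :
    ∃ M : ℝ, ∀ᵐ s ∂P, |f s| ≤ M := by
  refine ⟨(eLpNorm f ∞ P).toReal, ?_⟩
  filter_upwards [ae_le_eLpNormEssSup (f := f) (μ := P)] with s hs
  have h := ENNReal.toReal_mono hf.2.ne (by simpa using hs)
  simpa using h

theorem Payoff.converges_const (f : Payoff P k) : Converges (fun _ => f) f := by
  refine Converges.const f fun hk => ?_
  subst hk
  exact ae_abs_le_of_memLp_top f.2.2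

theorem Converges.subseq {f : ℕ → Payoff P k} {l : Payoff P k} (h : Converges f l)
    {u : ℕ → ℕ} (hu : Tendsto u atTop atTop) : Converges (fun n => f (u n)) l := by
  cases k with
  | bounded =>
    obtain ⟨⟨M, hM⟩, hlim⟩ := h
    refine ⟨⟨M, fun n => hM (u n)⟩, ?_⟩
    filter_upwards [hlim] with s hs using hs.comp hu
  | allMoments => exact fun p hp => (h p hp).comp hu

theorem Converges.add_sure {f : ℕ → Payoff P k} {l : Payoff P k} (h : Converges f l) (c : ℝ) :
    Converges (fun n => f n + sure P k c) (l + sure P k c) := by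
  cases k with
  | bounded =>
    obtain ⟨⟨M, hM⟩, hlim⟩ := h
    refine ⟨⟨M + |c|, fun n => ?_⟩, ?_⟩
    · filter_upwards [hM n] with s hs
      exact (abs_add_le _ _).trans (by simpa using hs)
    · filter_upwards [hlim] with s hs using hs.add_const c
  | allMoments =>
    intro p hp
    simpa using h p hp

/-- A payoff is the limit of its perturbations by ever smaller multiples of a fixed payoff. -/
theorem converges_add_smul (f d : Payoff P k) {a : ℕ → ℝ} (ha : Tendsto a atTop (𝓝 0)) :
    Converges (fun n => f + a n • d) f := by
  cases k with
  | bounded =>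
    obtain ⟨M, hM⟩ := ae_abs_le_of_memLp_top f.2.2
    obtain ⟨D, hD⟩ := ae_abs_le_of_memLp_top d.2.2
    obtain ⟨C, hC⟩ := (ha.abs.bddAbove_range)
    refine ⟨⟨M + C * D, fun n => ?_⟩, ?_⟩
    · filter_upwards [hM, hD] with s hs hs'
      refine (abs_add_le _ _).trans (add_le_add hs ?_)
      change |a n * (d : S → ℝ) s| ≤ _
      rw [abs_mul]
      have h1 : |a n| ≤ C := hC ⟨n, rfl⟩
      gcongr
      exact (abs_nonneg _).trans h1
    · refine ae_of_all _ fun s => ?_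
      have : Tendsto (fun n => (f : S → ℝ) s + a n * (d : S → ℝ) s) atTop
          (𝓝 ((f : S → ℝ) s + 0 * (d : S → ℝ) s)) := (ha.mul_const _).const_add _
      simpa using this
  | allMoments =>
    intro p hp
    have hp0 : p ≠ 0 := by omega
    have h : Tendsto (fun n => |a n| ^ p * ∫ s, |(d : S → ℝ) s| ^ p ∂P) atTop
        (𝓝 (|0| ^ p * ∫ s, |(d : S → ℝ) s| ^ p ∂P)) := (ha.abs.pow p).mul_const _
    simp only [abs_zero, ne_eq, hp0, not_false_eq_true, zero_pow, zero_mul] at h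
    refine h.congr fun n => ?_
    rw [← integral_const_mul]
    congr 1 with s
    simp [abs_mul, mul_pow]

theorem EqDist.symm {f g : Payoff P k} (h : EqDist f g) : EqDist g f := Eq.symm h

theorem EqDist.add_sure {f g : Payoff P k} (h : EqDist f g) (c : ℝ) :
    EqDist (f + sure P k c) (g + sure P k c) := by
  have key : ∀ u : Payoff P k, P.map ((u + sure P k c : Payoff P k) : S → ℝ) =
      (P.map (u : S → ℝ)).map (fun x => x + c) := by
    intro u
    rw [Measure.map_map (by fun_prop) u.2.1]
    rfl
  unfold EqDist at *
  rw [key, key, h]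

end Payoffs

/-! ### Transfer of rankings from one preference to another. -/

namespace RiskPreference

variable {S : Type*} [MeasurableSpace S] {P : Measure S} [IsProbabilityMeasure P]
  {k : PayoffClass} {A B : RiskPreference P k}

theorem prefers_refl (A : RiskPreference P k) (f : Payoff P k) : A.prefers f f :=
  (A.law_invariant f f rfl).1

theorem IsMonotone.add_sure_le (hA : A.IsMonotone) (f : Payoff P k) {c d : ℝ} (h : c ≤ d) :
    A.prefers (f + sure P k d) (f + sure P k c) := by
  rcases h.eq_or_lt with rfl | h
  · exact A.prefers_refl _
  · have := (hA (f + sure P k c) (d - c) (sub_pos.2 h)).1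
    rwa [add_assoc, ← sure_add, add_sub_cancel] at this

theorem IsMonotone.not_add_sure_lt (hA : A.IsMonotone) (f : Payoff P k) {c d : ℝ} (h : c < d) :
    ¬ A.prefers (f + sure P k c) (f + sure P k d) := by
  have := (hA (f + sure P k c) (d - c) (sub_pos.2 h)).2
  rwa [add_assoc, ← sure_add, add_sub_cancel] at this

theorem IsSecular.exists_indiff_add (hA : A.IsSecular) (f g : Payoff P k) :
    ∃ r : ℝ, A.Indiff g (f + sure P k r) := by
  obtain ⟨r, hr⟩ := hA f g
  refine ⟨-r, ?_⟩
  rwa [sure_neg, ← sub_eq_add_neg]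

theorem IsSecular.total (hA : A.IsSecular) (hm : A.IsMonotone) (f g : Payoff P k) :
    A.prefers f g ∨ A.prefers g f := by
  obtain ⟨r, h1, h2⟩ := hA.exists_indiff_add f g
  rcases le_total r 0 with h | h
  · left
    have := hm.add_sure_le f h
    rw [sure_zero, add_zero] at this
    exact A.trans _ _ _ this h2
  · right
    have := hm.add_sure_le f h
    rw [sure_zero, add_zero] at this
    exact A.trans _ _ _ h1 this

/-- Whenever `A` prefers a translate of `f` to a translate of `g`, so does `B`. -/
def TransfersRanking (A B : RiskPreference P k) (f g : Payoff P k) : Prop :=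
  ∀ c d : ℝ, A.prefers (f + sure P k d) (g + sure P k c) →
    B.prefers (f + sure P k d) (g + sure P k c)

theorem TransfersRanking.of_eqDist {f g : Payoff P k} (hA : A.IsMonotone) (hB : B.IsMonotone)
    (h : EqDist f g) : A.TransfersRanking B f g := by
  intro c d hcd
  have h1 := A.trans _ _ _ hcd (A.law_invariant _ _ (h.symm.add_sure c)).1
  have h2 : c ≤ d := by
    by_contra hlt
    exact hA.not_add_sure_lt f (not_le.1 hlt) h1
  exact B.trans _ _ _ (hB.add_sure_le f h2) (B.law_invariant _ _ (h.add_sure c)).1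

/-- Secularity of `A` supplies a translate of `g` that `A` finds indifferent to the given translate
of `h`; the two rankings are chained through it. -/
theorem TransfersRanking.trans {f g h : Payoff P k} (hs : A.IsSecular)
    (hfg : A.TransfersRanking B f g) (hgh : A.TransfersRanking B g h) :
    A.TransfersRanking B f h := by
  intro c d hcd
  obtain ⟨r, hr⟩ := hs.exists_indiff_add g (h + sure P k c)
  exact B.trans _ _ _ (hfg _ _ (A.trans _ _ _ hcd hr.1)) (hgh _ _ hr.2)

theorem TransfersRanking.congr_eqDist {f g f' g' : Payoff P k}
    (h : A.TransfersRanking B f g) (hf : EqDist f f') (hg : EqDist g g') :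
    A.TransfersRanking B f' g' := by
  intro c d hcd
  have h1 := A.trans _ _ _ (A.law_invariant _ _ (hf.add_sure d)).1
    (A.trans _ _ _ hcd (A.law_invariant _ _ (hg.add_sure c)).2)
  exact B.trans _ _ _ (B.law_invariant _ _ (hf.add_sure d)).2
    (B.trans _ _ _ (h _ _ h1) (B.law_invariant _ _ (hg.add_sure c)).1)

/-- A weak preference of `A` in the limit need not hold along the sequence. Raising `d` to `e > d`
makes it strict, so by totality and continuity it holds eventually; `B` inherits it, keeps it in the
limit, and finally `e` decreases to `d`. -/
theorem TransfersRanking.of_converges {f g : ℕ → Payoff P k} {f' g' : Payoff P k}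
    (hAc : A.IsContinuous) (hAm : A.IsMonotone) (hAs : A.IsSecular) (hBc : B.IsContinuous)
    (hf : Converges f f') (hg : Converges g g')
    (h : ∀ n, A.TransfersRanking B (f n) (g n)) : A.TransfersRanking B f' g' := by
  intro c d hcd
  have key : ∀ e > d, B.prefers (f' + sure P k e) (g' + sure P k c) := by
    intro e he
    have hev : ∀ᶠ n in atTop, A.prefers (f n + sure P k e) (g n + sure P k c) := by
      by_contra hcon
      obtain ⟨u, hu, hu'⟩ := extraction_of_frequently_atTop (not_eventually.1 hcon)
      have h1 := hAc _ _ _ _ ((hg.subseq hu.tendsto_atTop).add_sure c)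
        ((hf.subseq hu.tendsto_atTop).add_sure e)
        (fun n => (hAs.total hAm _ _).resolve_right (hu' n))
      exact hAm.not_add_sure_lt f' he (A.trans _ _ _ hcd h1)
    obtain ⟨N, hN⟩ := eventually_atTop.1 hev
    exact hBc _ _ _ _ ((hf.subseq (tendsto_add_atTop_nat N)).add_sure e)
      ((hg.subseq (tendsto_add_atTop_nat N)).add_sure c)
      (fun n => h _ _ _ (hN _ (Nat.le_add_left _ _)))
  have hlim := converges_add_smul (f' + sure P k d) (sure P k 1)
    tendsto_one_div_add_atTop_nhds_zero_nat
  refine hBc _ _ _ _ hlim (g' + sure P k c).converges_const fun n => ?_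
  have h2 := key (d + 1 / ((n : ℝ) + 1)) (lt_add_of_pos_right _ (by positivity))
  have h3 : f' + sure P k (d + 1 / ((n : ℝ) + 1)) =
      f' + sure P k d + (1 / ((n : ℝ) + 1)) • sure P k 1 := by
    ext s
    simp [add_assoc]
  rwa [h3] at h2

theorem TransfersRanking.price_le {f g : Payoff P k} (hB : B.IsMonotone)
    (h : A.TransfersRanking B f g) {a b : ℝ} (ha : A.Indiff g (f - sure P k a))
    (hb : B.Indiff g (f - sure P k b)) : a ≤ b := by
  have h1 := h 0 (-a)
  rw [sure_zero, add_zero, sure_neg, ← sub_eq_add_neg] at h1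
  have h2 := B.trans _ _ _ (h1 ha.2) hb.1
  rw [sub_eq_add_neg, sub_eq_add_neg, ← sure_neg, ← sure_neg] at h2
  by_contra hlt
  exact hB.not_add_sure_lt f (by linarith) h2

/-- The translate of `f` that `A` deems equivalent to `g + c` is `f + c` less the price of `A`. If
`f + d` is at least as good for `A`, then `d` is at least that constant, hence at least the one with
the larger price of `B`. -/
theorem TransfersRanking.of_price_le {f g : Payoff P k} (hAm : A.IsMonotone) (hAs : A.IsSecular)
    (hBm : B.IsMonotone) (hBs : B.IsSecular)
    (h : ∀ c : ℝ, A.price hAs (g + sure P k c) (f + sure P k c) ≤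
      B.price hBs (g + sure P k c) (f + sure P k c)) :
    A.TransfersRanking B f g := by
  intro c d hcd
  have hA := A.price_spec hAs (g + sure P k c) (f + sure P k c)
  have hB := B.price_spec hBs (g + sure P k c) (f + sure P k c)
  rw [sub_eq_add_neg, ← sure_neg, add_assoc, ← sure_add] at hA hB
  have h1 : c + -A.price hAs (g + sure P k c) (f + sure P k c) ≤ d := by
    by_contra hlt
    exact hAm.not_add_sure_lt f (not_le.1 hlt) (A.trans _ _ _ hcd hA.1)
  exact B.trans _ _ _ (hBm.add_sure_le f (by linarith [h c])) hB.2

/-- Since `I w` is stable under adding constants, all translates needed by `of_price_le` are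
obtained by changing the premium. -/
theorem MorePropenseToInsurance.transfersRanking {hAs : A.IsSecular} {hBs : B.IsSecular}
    {I : Payoff P k → Set (Payoff P k)} (h : B.MorePropenseToInsurance A hBs hAs I)
    (hAm : A.IsMonotone) (hBm : B.IsMonotone)
    (hI : ∀ w f c, f ∈ I w → f + sure P k c ∈ I w) {w f g : Payoff P k} (hgf : EqDist g f)
    (hf : f ∈ I w) : A.TransfersRanking B (w + f) (w + g) := by
  refine .of_price_le hAm hAs hBm hBs fun c => ?_
  rw [add_assoc, add_assoc]
  exact h w _ _ (hgf.add_sure c) (hI w f c hf)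

end RiskPreference

/-! ### Payoffs on equally likely cells, and transfers between cells. -/

section UniformLabels

variable {S : Type*} [MeasurableSpace S] {P : Measure S} [IsProbabilityMeasure P]
  {k : PayoffClass} {N : ℕ}

/-- A measurable labelling of the states all of whose labels are equally likely. -/
structure IsUniformLabel (P : Measure S) {N : ℕ} (κ : S → Fin N) : Prop where
  measurable : Measurable κ
  measure_eq : ∀ i j, P (κ ⁻¹' {i}) = P (κ ⁻¹' {j})

theorem memLp_comp_label {κ : S → Fin N} (hκ : Measurable κ) (x : Fin N → ℝ) (p : ℝ≥0∞) :
    MemLp (x ∘ κ) p P := by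
  obtain ⟨C, hC⟩ := (Set.finite_range fun i => ‖x i‖).bddAbove
  exact MemLp.of_bound ((measurable_of_finite x).comp hκ).aestronglyMeasurable C
    (ae_of_all _ fun s => hC ⟨κ s, rfl⟩)

/-- The payoff that pays `x i` on the states labelled `i`. -/
def labelPayoff (P : Measure S) [IsProbabilityMeasure P] (k : PayoffClass) {κ : S → Fin N}
    (hκ : Measurable κ) (x : Fin N → ℝ) : Payoff P k :=
  ⟨x ∘ κ, (measurable_of_finite x).comp hκ, by
    cases k with
    | bounded => exact memLp_comp_label hκ x ∞
    | allMoments => exact fun p => memLp_comp_label hκ x p⟩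

@[simp] theorem labelPayoff_apply {κ : S → Fin N} (hκ : Measurable κ) (x : Fin N → ℝ) (s : S) :
    (labelPayoff P k hκ x : S → ℝ) s = x (κ s) := rfl

theorem labelPayoff_add {κ : S → Fin N} (hκ : Measurable κ) (x y : Fin N → ℝ) :
    labelPayoff P k hκ (x + y) = labelPayoff P k hκ x + labelPayoff P k hκ y := rfl

theorem labelPayoff_smul {κ : S → Fin N} (hκ : Measurable κ) (c : ℝ) (x : Fin N → ℝ) :
    labelPayoff P k hκ (c • x) = c • labelPayoff P k hκ x := rfl

theorem IsUniformLabel.map_perm {κ : S → Fin N} (hκ : IsUniformLabel P κ)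
    (σ : Equiv.Perm (Fin N)) : P.map (σ ∘ κ) = P.map κ := by
  refine Measure.ext_of_singleton fun i => ?_
  rw [Measure.map_apply ((measurable_of_finite σ).comp hκ.measurable) (measurableSet_singleton i),
    Measure.map_apply hκ.measurable (measurableSet_singleton i), Set.preimage_comp]
  have : σ ⁻¹' {i} = {σ.symm i} := by
    ext j
    simp [Equiv.eq_symm_apply]
  rw [this, hκ.measure_eq]

theorem IsUniformLabel.eqDist_perm {κ : S → Fin N} (hκ : IsUniformLabel P κ) (x : Fin N → ℝ)
    (σ : Equiv.Perm (Fin N)) :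
    EqDist (labelPayoff P k hκ.measurable (x ∘ σ)) (labelPayoff P k hκ.measurable x) := by
  change P.map (x ∘ (σ ∘ κ)) = P.map (x ∘ κ)
  rw [← Measure.map_map (measurable_of_finite x) ((measurable_of_finite σ).comp hκ.measurable),
    hκ.map_perm, Measure.map_map (measurable_of_finite x) hκ.measurable]

/-- The vector `x` after a transfer of the amount `t` from position `i` to position `j`. -/
def transfer (x : Fin N → ℝ) (i j : Fin N) (t : ℝ) : Fin N → ℝ :=
  x + Pi.single j t - Pi.single i t

/-- With `x = w + f`, this expresses a transfer as the replacement of the insurance `f` by a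
permuted copy of it, which has the same law on equally likely cells. -/
theorem transfer_eq_sub_add_swap {x f : Fin N → ℝ} {i j : Fin N} {t : ℝ} (hij : i ≠ j)
    (ht : f i - f j = t) : transfer x i j t = x - f + f ∘ Equiv.swap i j := by
  subst ht
  ext l
  rcases eq_or_ne l i with rfl | hi
  · simp [transfer, hij]
    ring
  · rcases eq_or_ne l j with rfl | hj
    · simp [transfer, hij.symm]
      ring
    · simp [transfer, hi, hj, Equiv.swap_apply_of_ne_of_ne hi hj]

end UniformLabels

/-! ### From insurance to transfers between cells. -/

namespace RiskPreference

variable {S : Type*} [MeasurableSpace S] {P : Measure S} [IsProbabilityMeasure P]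
  {k : PayoffClass} {A B : RiskPreference P k} {N : ℕ}

/-- `B` dislikes more than `A` every transfer from a poorer to a richer label. -/
def TransfersRegressive (A B : RiskPreference P k) : Prop :=
  ∀ (N : ℕ) (κ : S → Fin N) (hκ : IsUniformLabel P κ) (x : Fin N → ℝ) (i j : Fin N) (t : ℝ),
    i ≠ j → x i ≤ x j → 0 < t →
    A.TransfersRanking B (labelPayoff P k hκ.measurable x)
      (labelPayoff P k hκ.measurable (transfer x i j t))

theorem MorePropenseToInsurance.transfersRanking_transfer {hAs : A.IsSecular} {hBs : B.IsSecular}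
    {I : Payoff P k → Set (Payoff P k)} (h : B.MorePropenseToInsurance A hBs hAs I)
    (hAm : A.IsMonotone) (hBm : B.IsMonotone)
    (hI : ∀ w f c, f ∈ I w → f + sure P k c ∈ I w) {κ : S → Fin N} (hκ : IsUniformLabel P κ)
    {x f : Fin N → ℝ} {i j : Fin N} {t : ℝ} (hij : i ≠ j) (ht : f i - f j = t)
    (hf : labelPayoff P k hκ.measurable f ∈ I (labelPayoff P k hκ.measurable (x - f))) :
    A.TransfersRanking B (labelPayoff P k hκ.measurable x)
      (labelPayoff P k hκ.measurable (transfer x i j t)) := by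
  have := h.transfersRanking hAm hBm hI (hκ.eqDist_perm f (Equiv.swap i j)) hf
  rwa [← labelPayoff_add, ← labelPayoff_add, sub_add_cancel,
    ← transfer_eq_sub_add_swap hij ht] at this

theorem MorePropenseToInsurance.transfersRegressive_of_deductibleLimit {hAs : A.IsSecular}
    {hBs : B.IsSecular} (h : B.MorePropenseToInsurance A hBs hAs deductibleLimitInsurance)
    (hAm : A.IsMonotone) (hBm : B.IsMonotone) : A.TransfersRegressive B := by
  intro N κ hκ x i j t hij hx ht
  have hI : ∀ (w f : Payoff P k) (c : ℝ), f ∈ deductibleLimitInsurance w →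
      f + sure P k c ∈ deductibleLimitInsurance w := by
    rintro w f c ⟨p, d, l, hl, hf⟩
    refine ⟨p - c, d, l, hl, fun s => ?_⟩
    have := hf s
    simp only [Submodule.coe_add, Pi.add_apply, sure_apply, this]
    ring
  -- The insurance pays `t` on `i` and on every cell strictly poorer than `i`, and nothing
  -- elsewhere, in particular nothing on `j`. For the risk `x - f` this is the contract with
  -- deductible `-x i` and limit `t`.
  refine h.transfersRanking_transfer hAm hBm hI hκ
    (f := fun l => if x l < x i ∨ l = i then t else 0) hij ?_ ?_
  · simp [hij.symm, not_lt.2 hx]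
  · refine ⟨0, -x i, t, ht.le, fun s => ?_⟩
    simp only [labelPayoff_apply, Pi.sub_apply]
    split_ifs with hs
    · have : x (κ s) ≤ x i := by
        rcases hs with hs | hs
        · exact hs.le
        · rw [hs]
      rw [max_eq_left (by linarith), min_eq_right (by linarith), sub_zero]
    · push Not at hs
      rw [max_eq_right (by linarith), min_eq_left ht.le, sub_zero]

theorem MorePropenseToInsurance.transfersRegressive_of_proportional {hAs : A.IsSecular}
    {hBs : B.IsSecular} (h : B.MorePropenseToInsurance A hBs hAs proportionalInsurance)
    (hAc : A.IsContinuous) (hAm : A.IsMonotone) (hBc : B.IsContinuous) (hBm : B.IsMonotone) :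
    A.TransfersRegressive B := by
  have hI : ∀ (w f : Payoff P k) (c : ℝ), f ∈ proportionalInsurance w →
      f + sure P k c ∈ proportionalInsurance w := by
    rintro w f c ⟨p, e, h0, h1, hf⟩
    refine ⟨p - c, e, h0, h1, fun s => ?_⟩
    have := hf s
    simp only [Submodule.coe_add, Pi.add_apply, sure_apply, this]
    ring
  -- A multiple of `x` can differ between `i` and `j` only if `x i ≠ x j`; ties are reached by
  -- continuity afterwards.
  have strict : ∀ (N : ℕ) (κ : S → Fin N) (hκ : IsUniformLabel P κ) (x : Fin N → ℝ) (i j : Fin N)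
      (t : ℝ), i ≠ j → x i < x j → 0 < t →
      A.TransfersRanking B (labelPayoff P k hκ.measurable x)
        (labelPayoff P k hκ.measurable (transfer x i j t)) := by
    intro N κ hκ x i j t hij hx ht
    have ha : 0 < x j - x i := sub_pos.2 hx
    refine h.transfersRanking_transfer hAm hBm hI hκ
      (f := fun l => -(t / (x j - x i)) * x l) hij ?_ ?_
    · field_simp
      ring
    -- With `a = x j - x i` and `f = -(t / a) x`, the risk is `w = (1 + t / a) x`, so `f = -(t / (a
    -- + t)) w` and the uninsured share is `a / (a + t)`.
    · refine ⟨0, (x j - x i) / (x j - x i + t), by positivity, ?_, fun s => ?_⟩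
      · rw [div_lt_one (by positivity)]
        linarith
      · simp only [labelPayoff_apply, Pi.sub_apply]
        field_simp
        ring
  intro N κ hκ x i j t hij hx ht
  have hlim := tendsto_one_div_add_atTop_nhds_zero_nat (𝕜 := ℝ)
  refine .of_converges hAc hAm hAs hBc
    -- Raising cell `j` by `1 / (n + 1)` on both sides breaks a possible tie.
    (converges_add_smul _ (labelPayoff P k hκ.measurable (Pi.single j 1)) hlim)
    (converges_add_smul _ (labelPayoff P k hκ.measurable (Pi.single j 1)) hlim) fun n => ?_
  have hn : 0 < 1 / ((n : ℝ) + 1) := by positivity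
  have := strict N κ hκ (x + (1 / ((n : ℝ) + 1)) • Pi.single j 1) i j t hij
    (by
      simp only [Pi.add_apply, Pi.smul_apply, Pi.single_eq_of_ne hij, Pi.single_eq_same,
        smul_eq_mul]
      linarith) ht
  rw [← labelPayoff_smul, ← labelPayoff_add, ← labelPayoff_add]
  convert this using 2
  unfold transfer
  abel

end RiskPreference

/-! ### Majorization through finitely many transfers. -/

namespace RiskPreference

variable {S : Type*} [MeasurableSpace S] {P : Measure S} [IsProbabilityMeasure P]
  {k : PayoffClass} {A B : RiskPreference P k} {N : ℕ}

/-- If the increasing vector `x` majorizes `y` from below, then `y` arises from `x` by transfers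
from poorer to richer labels, and the ranking transfers. -/
theorem TransfersRegressive.transfersRanking_of_prefix (h : A.TransfersRegressive B)
    (hAm : A.IsMonotone) (hAs : A.IsSecular) (hBm : B.IsMonotone) {κ : S → Fin N}
    (hκ : IsUniformLabel P κ) {x : Fin N → ℝ} (hx : Monotone x) (y : Fin N → ℝ)
    (hsum : ∑ l, y l = ∑ l, x l)
    (hpre : ∀ m, ∑ l ∈ Finset.Iic m, y l ≤ ∑ l ∈ Finset.Iic m, x l) :
    A.TransfersRanking B (labelPayoff P k hκ.measurable x)
      (labelPayoff P k hκ.measurable y) := by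
  classical
  -- Each step undoes one transfer in `y` so that at least one more coordinate agrees with `x`. Only
  -- `x` has to be increasing.
  induction hn : (Finset.univ.filter fun l => x l ≠ y l).card using Nat.strong_induction_on
    generalizing y with
  | _ n ih =>
  by_cases hxy : ∀ l, y l ≤ x l
  · have : y = x := by
      ext l
      exact (Finset.sum_eq_sum_iff_of_le fun l _ => hxy l).1 hsum l (Finset.mem_univ l)
    rw [this]
    exact .of_eqDist hAm hBm rfl
  push Not at hxy
  obtain ⟨j, hj, hjmin⟩ : ∃ j, x j < y j ∧ ∀ l < j, y l ≤ x l := by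
    obtain ⟨j, hj⟩ := (Finset.univ.filter fun l => x l < y l).exists_minimal (by
      obtain ⟨l, hl⟩ := hxy
      exact ⟨l, by simpa using hl⟩)
    refine ⟨j, by simpa using hj.prop, fun l hl => ?_⟩
    by_contra hcon
    exact hj.not_prop_of_lt hl (by simpa using hcon)
  -- Since `j` is in excess, the partial sum inequality at `j` forces an earlier deficit.
  obtain ⟨i, hi, hij⟩ : ∃ i, y i < x i ∧ i < j := by
    by_contra hcon
    push Not at hcon
    refine (hpre j).not_gt (Finset.sum_lt_sum (fun l hl => ?_) ⟨j, by simp, hj⟩)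
    rcases (Finset.mem_Iic.1 hl).eq_or_lt with rfl | hlt
    · exact hj.le
    · by_contra hl'
      exact (hcon l (not_le.1 hl')).not_gt hlt
  set t := min (x i - y i) (y j - x j) with ht
  have ht0 : 0 < t := lt_min (sub_pos.2 hi) (sub_pos.2 hj)
  have hti : t ≤ x i - y i := min_le_left _ _
  have htj : t ≤ y j - x j := min_le_right _ _
  set z := transfer y j i t with hz
  have hzi : z i = y i + t := by simp [hz, transfer, hij.ne]
  have hzj : z j = y j - t := by simp [hz, transfer, hij.ne']
  have hzl : ∀ l, l ≠ i → l ≠ j → z l = y l := fun l h1 h2 => by simp [hz, transfer, h1, h2]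
  have hzsum : ∀ s : Finset (Fin N), ∑ l ∈ s, z l =
      ∑ l ∈ s, y l + (if i ∈ s then t else 0) - (if j ∈ s then t else 0) := by
    intro s
    simp only [hz, transfer, Pi.add_apply, Pi.sub_apply, Finset.sum_sub_distrib,
      Finset.sum_add_distrib, Pi.single_apply, Finset.sum_ite_eq']
  have hzy : transfer z i j t = y := by
    simp only [hz, transfer]
    abel
  rw [← hzy]
  refine .trans hAs (ih _ ?_ z ?_ ?_ rfl) (h N κ hκ z i j t hij.ne ?_ ht0)
  · rw [← hn]
    refine Finset.card_lt_card ((Finset.ssubset_iff_of_subset fun l hl => ?_).2 ?_)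
    · simp only [Finset.mem_filter, Finset.mem_univ, true_and] at hl ⊢
      rcases eq_or_ne l i with rfl | h1
      · exact hi.ne'
      rcases eq_or_ne l j with rfl | h2
      · exact hj.ne
      rwa [hzl l h1 h2] at hl
    · rcases min_choice (x i - y i) (y j - x j) with hc | hc
      · refine ⟨i, by simpa using hi.ne', ?_⟩
        simp only [Finset.mem_filter, Finset.mem_univ, true_and, not_not, hzi, ht, hc]
        ring
      · refine ⟨j, by simpa using hj.ne, ?_⟩
        simp only [Finset.mem_filter, Finset.mem_univ, true_and, not_not, hzj, ht, hc]
        ring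
  · rw [hzsum, hsum]
    simp
  · intro m
    rw [hzsum]
    simp only [Finset.mem_Iic]
    by_cases hjm : j ≤ m
    · simpa [hjm, hij.le.trans hjm] using hpre m
    · by_cases him : i ≤ m
      -- Before the first excess `j` all differences are nonnegative, so the slack of the partial
      -- sum is at least `x i - y i ≥ t`, enough to absorb the amount returned to `i`.
      · have hnn : ∀ l ∈ Finset.Iic m, 0 ≤ x l - y l := fun l hl =>
          sub_nonneg.2 (hjmin l ((Finset.mem_Iic.1 hl).trans_lt (not_le.1 hjm)))
        have := Finset.single_le_sum hnn (Finset.mem_Iic.2 him)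
        rw [Finset.sum_sub_distrib] at this
        simp only [him, hjm, if_true, if_false]
        linarith
      · simpa [hjm, him] using hpre m
  -- By the choice of `t`, `z i ≤ x i ≤ x j ≤ z j`, so the transfer from `z` back to `y` does go
  -- from poorer to richer.
  · rw [hzi, hzj]
    linarith [hx hij.le]

end RiskPreference

/-! ### Expectations with values in the extended reals. -/

section ExtExpectation

variable {S : Type*} [MeasurableSpace S] {P : Measure S}

theorem extExpectation_of_integrable {X : S → ℝ} (hX : Integrable X P) :
    extExpectation P X = ((∫ s, X s ∂P : ℝ) : EReal) := by
  have h1 : ∫⁻ s, ENNReal.ofReal (X s) ∂P ≠ ∞ := hX.lintegral_lt_top.ne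
  have h2 : ∫⁻ s, ENNReal.ofReal (-X s) ∂P ≠ ∞ := hX.neg.lintegral_lt_top.ne
  rw [integral_eq_lintegral_pos_part_sub_lintegral_neg_part hX, EReal.coe_sub,
    EReal.coe_ennreal_toReal h1, EReal.coe_ennreal_toReal h2]
  rfl

theorem extExpectation_sub {X Y : S → ℝ} (hX : Integrable X P) (hY : Measurable Y)
    (hY0 : ∀ s, 0 ≤ Y s) :
    extExpectation P (fun s => X s - Y s) =
      ((∫ s, X s ∂P : ℝ) : EReal) - ((∫⁻ s, ENNReal.ofReal (Y s) ∂P : ℝ≥0∞) : EReal) := by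
  by_cases htop : ∫⁻ s, ENNReal.ofReal (Y s) ∂P = ∞
  · have hneg : ∫⁻ s, ENNReal.ofReal (-(X s - Y s)) ∂P = ∞ := by
      by_contra hne
      have hle : ∫⁻ s, ENNReal.ofReal (Y s) ∂P ≤
          ∫⁻ s, (ENNReal.ofReal (-(X s - Y s)) + ENNReal.ofReal (X s)) ∂P := by
        refine lintegral_mono fun s => ?_
        refine le_trans (ENNReal.ofReal_le_ofReal ?_) ENNReal.ofReal_add_le
        linarith
      rw [htop, lintegral_add_right' _ hX.aemeasurable.ennreal_ofReal, top_le_iff,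
        ENNReal.add_eq_top] at hle
      exact hle.elim hne hX.lintegral_lt_top.ne
    rw [extExpectation, hneg, htop]
    simp
  · have hYi : Integrable Y P := by
      refine ⟨hY.aestronglyMeasurable, ?_⟩
      rw [hasFiniteIntegral_iff_ofReal (ae_of_all _ hY0)]
      exact lt_top_iff_ne_top.2 htop
    rw [show (fun s => X s - Y s) = X - Y from rfl,
      extExpectation_of_integrable (hX.sub hYi), integral_sub' hX hYi, EReal.coe_sub,
      ← ofReal_integral_eq_lintegral_ofReal hYi (ae_of_all _ hY0),
      EReal.coe_ennreal_ofReal, max_eq_left (integral_nonneg hY0)]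

end ExtExpectation

/-! ### Stop-loss payoffs generate the concave order. -/

section StopLoss

/-- Tonelli for the region `0 < t ≤ s ≤ x`: its `t`-sections have length `(x - t)⁺`, its
`s`-sections have `D`-measure `D s - D 0`. -/
theorem lintegral_Ioi_ofReal_sub (D : StieltjesFunction ℝ) {x : ℝ} (hx : 0 ≤ x) :
    ∫⁻ t in Set.Ioi 0, ENNReal.ofReal (x - t) ∂D.measure =
      ENNReal.ofReal (∫ s in (0 : ℝ)..x, (D s - D 0)) := by
  have hE : MeasurableSet {z : ℝ × ℝ | 0 < z.1 ∧ z.1 ≤ z.2 ∧ z.2 ≤ x} := by measurability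
  have h1 := Measure.prod_apply (μ := D.measure) (ν := (volume : Measure ℝ)) hE
  have h2 := Measure.prod_apply_symm (μ := D.measure) (ν := (volume : Measure ℝ)) hE
  rw [h1] at h2
  have hm : Measurable fun s => D s - D 0 := D.mono.measurable.sub_const _
  have e1 : ∫⁻ t in Set.Ioi 0, ENNReal.ofReal (x - t) ∂D.measure =
      ∫⁻ t, volume (Prod.mk t ⁻¹' {z : ℝ × ℝ | 0 < z.1 ∧ z.1 ≤ z.2 ∧ z.2 ≤ x}) ∂D.measure := by
    rw [← lintegral_indicator measurableSet_Ioi]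
    congr 1 with t
    by_cases ht : 0 < t
    · rw [Set.indicator_of_mem (Set.mem_Ioi.2 ht), ← Real.volume_Icc]
      congr 1 with s
      simp [ht]
    · rw [Set.indicator_of_notMem (by simpa using ht)]
      simp [ht]
  rw [e1, h2, intervalIntegral.integral_of_le hx, ofReal_integral_eq_lintegral_ofReal,
    ← lintegral_indicator measurableSet_Ioc]
  · congr 1 with s
    by_cases hs : s ∈ Set.Ioc 0 x
    · rw [Set.indicator_of_mem hs, ← D.measure_Ioc]
      congr 1 with t
      simp [hs.2]
    · rw [Set.indicator_of_notMem hs]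
      have : (fun t => (t, s)) ⁻¹' {z : ℝ × ℝ | 0 < z.1 ∧ z.1 ≤ z.2 ∧ z.2 ≤ x} = ∅ := by
        ext t
        simp only [Set.mem_preimage, Set.mem_ofPred_eq, Set.mem_empty_iff_false, iff_false]
        exact fun h => hs ⟨h.1.trans_le h.2.1, h.2.2⟩
      rw [this, measure_empty]
  · have := (D.mono.intervalIntegrable (μ := volume) (a := 0) (b := x)).sub
      (intervalIntegrable_const (c := D 0))
    rwa [intervalIntegrable_iff_integrableOn_Ioc_of_le hx] at this
  · filter_upwards [ae_restrict_mem measurableSet_Ioc] with s hs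
    exact sub_nonneg.2 (D.mono hs.1.le)

theorem lintegral_Iic_ofReal_sub (D : StieltjesFunction ℝ) {x : ℝ} (hx : x ≤ 0) :
    ∫⁻ t in Set.Iic 0, ENNReal.ofReal (t - x) ∂D.measure =
      ENNReal.ofReal (∫ s in x..(0 : ℝ), (D 0 - D s)) := by
  have hE : MeasurableSet {z : ℝ × ℝ | z.1 ≤ 0 ∧ z.2 < z.1 ∧ x < z.2} := by measurability
  have h1 := Measure.prod_apply (μ := D.measure) (ν := (volume : Measure ℝ)) hE
  have h2 := Measure.prod_apply_symm (μ := D.measure) (ν := (volume : Measure ℝ)) hE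
  rw [h1] at h2
  have hm : Measurable fun s => D 0 - D s := D.mono.measurable.const_sub _
  have e1 : ∫⁻ t in Set.Iic 0, ENNReal.ofReal (t - x) ∂D.measure =
      ∫⁻ t, volume (Prod.mk t ⁻¹' {z : ℝ × ℝ | z.1 ≤ 0 ∧ z.2 < z.1 ∧ x < z.2}) ∂D.measure := by
    rw [← lintegral_indicator measurableSet_Iic]
    congr 1 with t
    by_cases ht : t ≤ 0
    · rw [Set.indicator_of_mem (Set.mem_Iic.2 ht), ← Real.volume_Ioo]
      congr 1 with s
      simp [ht, and_comm]
    · rw [Set.indicator_of_notMem (by simpa using ht)]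
      simp [ht]
  rw [e1, h2, intervalIntegral.integral_of_le hx, ofReal_integral_eq_lintegral_ofReal,
    ← lintegral_indicator measurableSet_Ioc]
  · congr 1 with s
    by_cases hs : s ∈ Set.Ioc x 0
    · rw [Set.indicator_of_mem hs, ← D.measure_Ioc]
      congr 1 with t
      simp [hs.1, and_comm]
    · rw [Set.indicator_of_notMem hs]
      have : (fun t => (t, s)) ⁻¹' {z : ℝ × ℝ | z.1 ≤ 0 ∧ z.2 < z.1 ∧ x < z.2} = ∅ := by
        ext t
        simp only [Set.mem_preimage, Set.mem_ofPred_eq, Set.mem_empty_iff_false, iff_false]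
        exact fun h => hs ⟨h.2.2, h.2.1.le.trans h.1⟩
      rw [this, measure_empty]
  · have := (intervalIntegrable_const (c := D 0)).sub
      (D.mono.intervalIntegrable (μ := volume) (a := x) (b := 0))
    rwa [intervalIntegrable_iff_integrableOn_Ioc_of_le hx] at this
  · filter_upwards [ae_restrict_mem measurableSet_Ioc] with s hs
    exact sub_nonneg.2 (D.mono hs.2)

/-- A convex function is the primitive of a right-continuous increasing function. -/
theorem ConvexOn.exists_stieltjes {ψ : ℝ → ℝ} (hψ : ConvexOn ℝ Set.univ ψ) :
    ∃ D : StieltjesFunction ℝ, ∀ x y, ∫ s in x..y, D s = ψ y - ψ x := by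
  have hmono : Monotone fun x => derivWithin ψ (Set.Ioi x) x := by
    have := hψ.monotoneOn_rightDeriv
    rwa [interior_univ, monotoneOn_univ] at this
  refine ⟨hmono.stieltjesFunction, fun x y => ?_⟩
  have hcont : Continuous ψ := continuousOn_univ.1 (hψ.continuousOn isOpen_univ)
  have hFTC := intervalIntegral.integral_eq_sub_of_hasDeriv_right (a := x) (b := y)
    hcont.continuousOn
    (fun s _ => hψ.hasDerivWithinAt_rightDeriv_of_mem_interior (by simp : s ∈ interior Set.univ))
    hmono.intervalIntegrable
  rw [← hFTC]
  refine intervalIntegral.integral_congr_ae ?_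
  -- Passing to right limits alters a monotone function at most at its countably many
  -- discontinuities.
  filter_upwards [hmono.countable_not_continuousAt.ae_notMem volume] with s hs _
  rw [hmono.stieltjesFunction_eq]
  have hc : ContinuousAt (fun x => derivWithin ψ (Set.Ioi x) x) s := by simpa using hs
  exact hc.continuousWithinAt.rightLim_eq

/-- The stop-loss representation of a convex function. -/
theorem ConvexOn.exists_stopLoss {ψ : ℝ → ℝ} (hψ : ConvexOn ℝ Set.univ ψ) :
    ∃ (μ : Measure ℝ) (a b : ℝ), SFinite μ ∧ (∀ x, 0 ≤ ψ x - (a * x + b)) ∧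
      ∀ x, ENNReal.ofReal (ψ x - (a * x + b)) =
        ∫⁻ t in Set.Ioi 0, ENNReal.ofReal (x - t) ∂μ +
          ∫⁻ t in Set.Iic 0, ENNReal.ofReal (t - x) ∂μ := by
  obtain ⟨D, hD⟩ := ConvexOn.exists_stieltjes hψ
  have hpos : ∀ x, ψ x - (D 0 * x + ψ 0) = ∫ s in (0 : ℝ)..x, (D s - D 0) := by
    intro x
    rw [intervalIntegral.integral_sub D.mono.intervalIntegrable intervalIntegrable_const, hD]
    simp
    ring
  have hneg : ∀ x, ψ x - (D 0 * x + ψ 0) = ∫ s in x..(0 : ℝ), (D 0 - D s) := by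
    intro x
    rw [intervalIntegral.integral_sub intervalIntegrable_const D.mono.intervalIntegrable, hD]
    simp
    ring
  -- The subtracted line supports `ψ` at `0`. Splitting the thresholds at `0` makes one of the two
  -- mixtures vanish on each half-line.
  refine ⟨D.measure, D 0, ψ 0, inferInstance, fun x => ?_, fun x => ?_⟩
  · rcases le_total 0 x with hx | hx
    · rw [hpos]
      exact intervalIntegral.integral_nonneg hx fun s hs => sub_nonneg.2 (D.mono hs.1)
    · rw [hneg]
      exact intervalIntegral.integral_nonneg hx fun s hs => sub_nonneg.2 (D.mono hs.2)
  · rcases le_total 0 x with hx | hx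
    · rw [hpos, ← lintegral_Ioi_ofReal_sub D hx]
      convert (add_zero _).symm
      refine setLIntegral_eq_zero measurableSet_Iic fun t ht => ?_
      exact ENNReal.ofReal_of_nonpos (sub_nonpos.2 ((Set.mem_Iic.1 ht).trans hx))
    · rw [hneg, ← lintegral_Iic_ofReal_sub D hx]
      convert (zero_add _).symm
      refine setLIntegral_eq_zero measurableSet_Ioi fun t ht => ?_
      exact ENNReal.ofReal_of_nonpos (sub_nonpos.2 (hx.trans (Set.mem_Ioi.1 ht).le))

variable {S : Type*} [MeasurableSpace S] {P : Measure S} [IsProbabilityMeasure P]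

/-- Put-call parity: with equal means, comparing puts is the same as comparing calls. -/
theorem lintegral_ofReal_sub_const_eq {X : S → ℝ} (hX : Integrable X P) (c : ℝ) :
    ∫⁻ s, ENNReal.ofReal (X s - c) ∂P =
      ENNReal.ofReal ((∫ s, X s ∂P) - c + (∫⁻ s, ENNReal.ofReal (c - X s) ∂P).toReal) := by
  have hXc : Integrable (fun s => X s - c) P := hX.sub (integrable_const c)
  have h := integral_eq_lintegral_pos_part_sub_lintegral_neg_part hXc
  rw [integral_sub hX (integrable_const c)] at h
  simp only [integral_const, probReal_univ, one_smul, neg_sub] at h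
  rw [h, sub_add_cancel, ENNReal.ofReal_toReal hXc.lintegral_lt_top.ne]

/-- Comparison of stop-loss premia extends to all concave functions. -/
theorem extExpectation_le_of_stopLoss {F G : S → ℝ} (hFm : Measurable F) (hGm : Measurable G)
    (hF : Integrable F P) (hG : Integrable G P) (hmean : ∫ s, F s ∂P = ∫ s, G s ∂P)
    (hle : ∀ c : ℝ, ∫⁻ s, ENNReal.ofReal (c - F s) ∂P ≤ ∫⁻ s, ENNReal.ofReal (c - G s) ∂P)
    {φ : ℝ → ℝ} (hφ : ConcaveOn ℝ Set.univ φ) :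
    extExpectation P (fun s => φ (G s)) ≤ extExpectation P (fun s => φ (F s)) := by
  have hle' : ∀ c : ℝ,
      ∫⁻ s, ENNReal.ofReal (F s - c) ∂P ≤ ∫⁻ s, ENNReal.ofReal (G s - c) ∂P := by
    intro c
    have hfin : ∫⁻ s, ENNReal.ofReal (c - G s) ∂P ≠ ∞ :=
      ((integrable_const c).sub hG).lintegral_lt_top.ne
    rw [lintegral_ofReal_sub_const_eq hF, lintegral_ofReal_sub_const_eq hG, hmean]
    exact ENNReal.ofReal_le_ofReal (add_le_add le_rfl (ENNReal.toReal_mono hfin (hle c)))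
  obtain ⟨μ, a, b, hμ, hnn, hrep⟩ := ConvexOn.exists_stopLoss hφ.neg
  have hcont : Continuous φ := continuousOn_univ.1 (hφ.continuousOn isOpen_univ)
  -- By Tonelli, the expectation is an affine term, fixed by the mean, minus a mixture of stop-loss
  -- values that may be infinite.
  have hext : ∀ X : S → ℝ, Measurable X → Integrable X P → extExpectation P (fun s => φ (X s)) =
      ((∫ s, -(a * X s + b) ∂P : ℝ) : EReal) -
        ((∫⁻ t in Set.Ioi 0, (∫⁻ s, ENNReal.ofReal (X s - t) ∂P) ∂μ +
          ∫⁻ t in Set.Iic 0, (∫⁻ s, ENNReal.ofReal (t - X s) ∂P) ∂μ : ℝ≥0∞) : EReal) := by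
    intro X hXm hX
    have h1 : Integrable (fun s => -(a * X s + b)) P :=
      ((hX.const_mul a).add (integrable_const b)).neg
    have h2 : Measurable fun s => (-φ) (X s) - (a * X s + b) :=
      ((hcont.measurable.neg).comp hXm).sub ((hXm.const_mul a).add_const b)
    have h3 := extExpectation_sub h1 h2 fun s => hnn (X s)
    have e1 := lintegral_lintegral_swap (μ := P) (ν := μ.restrict (Set.Ioi 0))
      (f := fun s t => ENNReal.ofReal (X s - t)) (by fun_prop)
    have e2 := lintegral_lintegral_swap (μ := P) (ν := μ.restrict (Set.Iic 0))
      (f := fun s t => ENNReal.ofReal (t - X s)) (by fun_prop)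
    have e3 : Measurable fun s => ∫⁻ t in Set.Ioi 0, ENNReal.ofReal (X s - t) ∂μ :=
      Measurable.lintegral_prod_right' (f := fun z : S × ℝ => ENNReal.ofReal (X z.1 - z.2))
        (by fun_prop)
    rw [← e1, ← e2, ← lintegral_add_left e3]
    simp only [hrep] at h3
    rw [← h3]
    congr 1 with s
    simp only [Pi.neg_apply]
    ring
  rw [hext F hFm hF, hext G hGm hG]
  refine EReal.sub_le_sub (le_of_eq ?_) ?_
  · rw [integral_neg, integral_neg, integral_add (hG.const_mul a) (integrable_const b),
      integral_add (hF.const_mul a) (integrable_const b), integral_const_mul, integral_const_mul,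
      hmean]
  · rw [EReal.coe_ennreal_le_coe_ennreal_iff]
    exact add_le_add (lintegral_mono fun t => hle' t) (lintegral_mono fun t => hle t)

end StopLoss

/-! ### Better hedges and the concave order. -/

section Hedging

variable {S : Type*} [MeasurableSpace S] {P : Measure S} [IsProbabilityMeasure P]
  {k : PayoffClass}

theorem Payoff.integrable (f : Payoff P k) : Integrable (f : S → ℝ) P := by
  have hf := f.2.2
  rw [← memLp_one_iff_integrable]
  cases k with
  | bounded => exact MemLp.mono_exponent (q := ∞) hf le_top
  | allMoments => exact_mod_cast hf 1

theorem EqDist.integral_eq {f g : Payoff P k} (h : EqDist f g) :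
    ∫ s, (f : S → ℝ) s ∂P = ∫ s, (g : S → ℝ) s ∂P := by
  have hf := integral_map (μ := P) (φ := (f : S → ℝ)) f.2.1.aemeasurable
    (f := id) aestronglyMeasurable_id
  have hg := integral_map (μ := P) (φ := (g : S → ℝ)) g.2.1.aemeasurable
    (f := id) aestronglyMeasurable_id
  simp only [id] at hf hg
  rw [← hf, ← hg, h]

theorem EqDist.measure_le {f g : Payoff P k} (h : EqDist f g) (τ : ℝ) :
    P {s | (f : S → ℝ) s ≤ τ} = P {s | (g : S → ℝ) s ≤ τ} := by
  have := congrArg (fun μ : Measure ℝ => μ (Set.Iic τ)) h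
  simp only [Measure.map_apply f.2.1 measurableSet_Iic,
    Measure.map_apply g.2.1 measurableSet_Iic] at this
  exact this

theorem Payoff.measurableSet_le (f : Payoff P k) (τ : ℝ) :
    MeasurableSet {s | (f : S → ℝ) s ≤ τ} :=
  _root_.measurableSet_le f.2.1 measurable_const

theorem BetterHedge.measure_inter_le {w f g : Payoff P k} (h : BetterHedge w f g) (τ l : ℝ) :
    P ({s | (w : S → ℝ) s ≤ l} ∩ {s | (f : S → ℝ) s ≤ τ}) ≤
      P ({s | (w : S → ℝ) s ≤ l} ∩ {s | (g : S → ℝ) s ≤ τ}) := by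
  have := h.2 τ l
  rw [cond_apply (w.measurableSet_le l), cond_apply (w.measurableSet_le l)] at this
  by_cases h0 : P {s | (w : S → ℝ) s ≤ l} = 0
  · rw [measure_inter_null_of_null_left _ h0]
    exact zero_le
  · rwa [ENNReal.mul_le_mul_iff_right (ENNReal.inv_ne_zero.2 (measure_ne_top _ _))
      (ENNReal.inv_ne_top.2 h0)] at this

/-- Pointwise, `(c - w - f)⁺` is the length of the interval `[w, c - f]`, that is, of the set of `l`
with `w ≤ l` and `f ≤ c - l`. -/
theorem lintegral_ofReal_sub_add (w f : Payoff P k) (c : ℝ) :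
    ∫⁻ s, ENNReal.ofReal (c - ((w : S → ℝ) s + (f : S → ℝ) s)) ∂P =
      ∫⁻ l, P ({s | (w : S → ℝ) s ≤ l} ∩ {s | (f : S → ℝ) s ≤ c - l}) := by
  have hw := w.2.1
  have hf := f.2.1
  have hE : MeasurableSet {z : S × ℝ | (w : S → ℝ) z.1 ≤ z.2 ∧ (f : S → ℝ) z.1 ≤ c - z.2} :=
    (_root_.measurableSet_le (hw.comp measurable_fst) measurable_snd).inter
      (_root_.measurableSet_le (hf.comp measurable_fst) (measurable_snd.const_sub c))
  have h := Measure.prod_apply_symm (μ := P) (ν := (volume : Measure ℝ)) hE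
  rw [Measure.prod_apply hE] at h
  refine Eq.trans ?_ h
  congr 1 with s
  rw [← sub_sub, sub_right_comm, ← Real.volume_Icc]
  congr 1 with l
  simp [le_sub_comm]

theorem BetterHedge.concaveGE {w f g : Payoff P k} (h : BetterHedge w f g) :
    ConcaveGE (w + f) (w + g) := by
  intro φ hφ
  refine extExpectation_le_of_stopLoss (w + f).2.1 (w + g).2.1 (w + f).integrable
    (w + g).integrable ?_ (fun c => ?_) hφ
  · simp only [Submodule.coe_add, Pi.add_apply]
    rw [integral_add w.integrable f.integrable, integral_add w.integrable g.integrable,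
      h.1.integral_eq]
  · simp only [Submodule.coe_add, Pi.add_apply]
    rw [lintegral_ofReal_sub_add, lintegral_ofReal_sub_add]
    exact lintegral_mono fun l => h.measure_inter_le _ _

theorem betterHedge_of_contingencySchedule {w f g : Payoff P k} (hfg : EqDist f g)
    (hf : f ∈ contingencyScheduleInsurance w) : BetterHedge w f g := by
  refine ⟨hfg, fun τ l => ?_⟩
  rw [cond_apply (w.measurableSet_le l), cond_apply (w.measurableSet_le l)]
  gcongr _ * ?_
  set W := {s | (w : S → ℝ) s ≤ l} with hW
  have hWm : MeasurableSet W := w.measurableSet_le l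
  set E : Payoff P k → Set S := fun u => {s | (u : S → ℝ) s ≤ τ} with hE
  have hEm : ∀ u, MeasurableSet (E u) := fun u => u.measurableSet_le τ
  change P (W ∩ E f) ≤ P (W ∩ E g)
  -- A pair of states from these two sets has a larger loss with a smaller payment, which a
  -- contingency schedule excludes almost surely.
  have hprod : P (W ∩ E f) * P (Wᶜ ∩ (E f)ᶜ) = 0 := by
    rw [← Measure.prod_prod]
    refine measure_mono_null (fun z hz => ?_) (ae_iff.1 hf)
    obtain ⟨⟨h1, h2⟩, h3, h4⟩ := hz
    simp only [hW, hE, Set.mem_ofPred_eq, Set.mem_compl_iff, not_le] at h1 h2 h3 h4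
    simp only [Set.mem_ofPred_eq, gt_iff_lt, ge_iff_le, Classical.not_imp, not_le]
    exact ⟨by linarith, by linarith⟩
  rcases mul_eq_zero.1 hprod with h0 | h0
  · rw [h0]
    exact zero_le
  -- With both marginals fixed, `P (W ∩ E u)` and `P (Wᶜ ∩ (E u)ᶜ)` differ by a constant, so one is
  -- minimal when the other is zero.
  have key : ∀ u : Payoff P k,
      P Wᶜ + P (W ∩ E u) = P (E u) + P (Wᶜ ∩ (E u)ᶜ) := by
    intro u
    have h1 := measure_inter_add_sdiff (μ := P) Wᶜ (hEm u)
    have h2 := measure_inter_add_sdiff (μ := P) (E u) hWm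
    rw [Set.sdiff_eq] at h1 h2
    rw [← h1, ← h2, Set.inter_comm W, Set.inter_comm (E u) Wᶜ]
    ring
  have h1 : P Wᶜ + P (W ∩ E f) ≤ P Wᶜ + P (W ∩ E g) := by
    rw [key, key, h0, add_zero, hE, hfg.measure_le τ]
    exact le_self_add
  exact (ENNReal.add_le_add_iff_left (measure_ne_top _ _)).1 h1

end Hedging

/-! ### Quantile functions and the probability integral transform. -/

section Quantile

/-- The quantile function of a distribution on the line, extended by zero outside the open unit
interval. -/
noncomputable def quantile (μ : Measure ℝ) : ℝ → ℝ :=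
  (Set.Ioo 0 1).indicator fun u => sInf {x | u ≤ cdf μ x}

variable (μ : Measure ℝ)

theorem quantile_le_iff {u : ℝ} (hu : u ∈ Set.Ioo (0 : ℝ) 1) (x : ℝ) :
    quantile μ u ≤ x ↔ u ≤ cdf μ x := by
  rw [quantile, Set.indicator_of_mem hu]
  have hne : {x | u ≤ cdf μ x}.Nonempty :=
    ((tendsto_cdf_atTop μ).eventually_const_lt hu.2).exists.imp fun _ hx => hx.le
  have hbdd : BddBelow {x | u ≤ cdf μ x} := by
    obtain ⟨b, hb⟩ := ((tendsto_cdf_atBot μ).eventually_lt_const hu.1).exists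
    exact ⟨b, fun x hx => le_of_not_gt fun hxb =>
      (hx.trans (monotone_cdf μ hxb.le)).not_gt hb⟩
  constructor
  · intro h
    have hlim : Tendsto (cdf μ) (𝓝[>] x) (𝓝 (cdf μ x)) :=
      ((cdf μ).right_continuous x).mono Set.Ioi_subset_Ici_self
    refine ge_of_tendsto hlim ?_
    filter_upwards [self_mem_nhdsWithin] with y hy
    obtain ⟨z, hz, hzy⟩ := (csInf_lt_iff hbdd hne).1 (h.trans_lt hy)
    exact hz.trans (monotone_cdf μ hzy.le)
  · exact fun h => csInf_le hbdd h

theorem monotoneOn_quantile : MonotoneOn (quantile μ) (Set.Ioo 0 1) := fun _ hu _ hv huv =>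
  (quantile_le_iff μ hu _).2 (huv.trans ((quantile_le_iff μ hv _).1 le_rfl))

theorem measurable_quantile : Measurable (quantile μ) := by
  refine measurable_of_Iic fun x => ?_
  have : quantile μ ⁻¹' Set.Iic x =
      (Set.Ioo 0 1 ∩ Set.Iic (cdf μ x)) ∪ ((Set.Ioo 0 1)ᶜ ∩ {_u | 0 ≤ x}) := by
    ext u
    by_cases hu : u ∈ Set.Ioo (0 : ℝ) 1
    · simp only [Set.mem_preimage, Set.mem_Iic, quantile_le_iff μ hu, Set.mem_union,
        Set.mem_inter_iff, hu, true_and, Set.mem_compl_iff, not_true, false_and, or_false]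
    · simp [quantile, hu]
  rw [this]
  exact (measurableSet_Ioo.inter measurableSet_Iic).union
    (measurableSet_Ioo.compl.inter (MeasurableSet.const _))

theorem map_quantile [IsProbabilityMeasure μ] :
    (volume.restrict (Set.Ioo (0 : ℝ) 1)).map (quantile μ) = μ := by
  have : IsProbabilityMeasure (volume.restrict (Set.Ioo (0 : ℝ) 1)) := ⟨by simp⟩
  have := Measure.isProbabilityMeasure_map (μ := volume.restrict (Set.Ioo (0 : ℝ) 1))
    (measurable_quantile μ).aemeasurable
  refine Measure.ext_of_Iic _ _ fun x => ?_
  rw [Measure.map_apply (measurable_quantile μ) measurableSet_Iic, ← ofReal_cdf μ x,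
    Measure.restrict_apply (measurable_quantile μ measurableSet_Iic)]
  have h1 : quantile μ ⁻¹' Set.Iic x ∩ Set.Ioo 0 1 = Set.Iic (cdf μ x) ∩ Set.Ioo 0 1 := by
    ext u
    simp only [Set.mem_inter_iff, Set.mem_preimage, Set.mem_Iic, and_congr_left_iff]
    exact fun hu => quantile_le_iff μ hu x
  have h2 : Set.Iic (cdf μ x) ∩ Set.Ioc (0 : ℝ) 1 = Set.Ioc 0 (cdf μ x) := by
    ext u
    simp only [Set.mem_inter_iff, Set.mem_Iic, Set.mem_Ioc]
    exact ⟨fun h => ⟨h.2.1, h.1⟩, fun h => ⟨h.2, h.1, h.2.trans (cdf_le_one μ x)⟩⟩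
  rw [h1, measure_congr (ae_eq_rfl.inter Ioo_ae_eq_Ioc), h2, Real.volume_Ioc, sub_zero]

theorem cdf_quantile [IsProbabilityMeasure μ] (hμ : ∀ x, μ {x} = 0) {u : ℝ}
    (hu : u ∈ Set.Ioo (0 : ℝ) 1) : cdf μ (quantile μ u) = u := by
  refine le_antisymm ?_ ((quantile_le_iff μ hu _).1 le_rfl)
  have h1 := hμ (quantile μ u)
  rw [← measure_cdf μ, StieltjesFunction.measure_singleton, measure_cdf μ,
    ENNReal.ofReal_eq_zero, sub_nonpos] at h1
  refine h1.trans (le_of_tendsto ((monotone_cdf μ).tendsto_leftLim _) ?_)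
  filter_upwards [self_mem_nhdsWithin] with y hy
  by_contra hlt
  exact (not_lt.2 ((quantile_le_iff μ hu y).2 (not_le.1 hlt).le)) hy

/-- Write `μ` as the image of Lebesgue measure under its quantile function, of which the
distribution function is a left inverse when there are no atoms. -/
theorem map_cdf [IsProbabilityMeasure μ] (hμ : ∀ x, μ {x} = 0) :
    μ.map (cdf μ) = volume.restrict (Set.Ioo (0 : ℝ) 1) := by
  have h : μ.map (cdf μ) =
      ((volume.restrict (Set.Ioo (0 : ℝ) 1)).map (quantile μ)).map (cdf μ) := by
    rw [map_quantile μ]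
  rw [h, Measure.map_map (monotone_cdf μ).measurable (measurable_quantile μ)]
  refine (Measure.map_congr (g := id) ?_).trans Measure.map_id
  filter_upwards [ae_restrict_mem measurableSet_Ioo] with u hu using cdf_quantile μ hμ hu

end Quantile

/-! ### A uniform random variable on a nonatomic space. -/

section Nonatomic

variable {S : Type*} [MeasurableSpace S] {P : Measure S} [IsProbabilityMeasure P]

/-- A nonatomic probability space carries a random variable with diffuse distribution. -/
theorem IsNonatomic.exists_diffuse (hP : IsNonatomic P) :
    ∃ X : S → ℝ, Measurable X ∧ ∀ x, P (X ⁻¹' {x}) = 0 := by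
  -- The diffuse variable is found by minimizing the probability that two independent draws agree.
  let tie : (S → ℝ) → ℝ≥0∞ := fun X => (P.prod P) {z | X z.1 = X z.2}
  obtain ⟨X, hX, hmin⟩ : ∃ X : S → ℝ, Measurable X ∧ ∀ Y, Measurable Y → tie X ≤ tie Y := by
    have hne : (tie '' {X | Measurable X}).Nonempty := ⟨_, 0, measurable_zero, rfl⟩
    obtain ⟨v, -, hv, hmem⟩ := exists_seq_tendsto_sInf hne (OrderBot.bddBelow _)
    choose X hXm hXv using hmem
    -- The infimum is attained: a minimizing sequence is coded injectively into one real variable,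
    -- which ties only where all its members tie.
    let e := embeddingReal (ℕ → ℝ)
    have he : MeasurableEmbedding e := measurableEmbedding_embeddingReal _
    refine ⟨fun s => e fun n => X n s, he.measurable.comp (measurable_pi_lambda _ hXm),
      fun Y hY => ?_⟩
    refine le_trans (b := sInf (tie '' {X | Measurable X})) ?_ (sInf_le ⟨Y, hY, rfl⟩)
    refine ge_of_tendsto' hv fun n => ?_
    rw [← hXv n]
    exact measure_mono fun z hz => congrFun (he.injective hz) n
  refine ⟨X, hX, fun x => ?_⟩
  by_contra hpos
  have hAm := hX (measurableSet_singleton x)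
  obtain ⟨C, hCA, hCm, hC0, hCA'⟩ := hP _ hAm (pos_iff_ne_zero.2 hpos)
  let e := embeddingReal (ℝ × ℝ)
  have he : MeasurableEmbedding e := measurableEmbedding_embeddingReal _
  -- Refining `X` by the indicator of `C` separates `C` from the rest of the atom, so the tie
  -- probability drops strictly.
  let Y : S → ℝ := fun s => e (X s, C.indicator 1 s)
  have hY : Measurable Y := he.measurable.comp (hX.prodMk (measurable_one.indicator hCm))
  refine (hmin Y hY).not_gt ?_
  have hD : P (X ⁻¹' {x} \ C) ≠ 0 := by
    rw [measure_sdiff hCA hCm.nullMeasurableSet (measure_ne_top _ _)]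
    exact (tsub_pos_of_lt hCA').ne'
  have hCD : (P.prod P) (C ×ˢ (X ⁻¹' {x} \ C)) ≠ 0 := by
    rw [Measure.prod_prod]
    exact mul_ne_zero hC0.ne' hD
  have hYset : MeasurableSet {z : S × S | Y z.1 = Y z.2} :=
    measurableSet_eq_fun (hY.comp measurable_fst) (hY.comp measurable_snd)
  have hdisj : Disjoint {z : S × S | Y z.1 = Y z.2} (C ×ˢ (X ⁻¹' {x} \ C)) := by
    rw [Set.disjoint_left]
    rintro ⟨s, s'⟩ h1 ⟨h2, h3⟩
    have h4 := congrArg Prod.snd (he.injective h1)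
    simp only at h2 h3 h4
    rw [Set.indicator_of_mem h2, Set.indicator_of_notMem h3.2] at h4
    exact one_ne_zero h4
  calc tie Y < tie Y + (P.prod P) (C ×ˢ (X ⁻¹' {x} \ C)) :=
        ENNReal.lt_add_right (measure_ne_top _ _) hCD
    _ = (P.prod P) ({z | Y z.1 = Y z.2} ∪ C ×ˢ (X ⁻¹' {x} \ C)) :=
        (measure_union hdisj (hCm.prod (hAm.diff hCm))).symm
    _ ≤ tie X := by
        refine measure_mono (Set.union_subset (fun z hz => ?_) ?_)
        · exact congrArg Prod.fst (he.injective hz)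
        · rintro ⟨s, s'⟩ ⟨h1, h2⟩
          exact (hCA h1 : X s = x).trans (h2.1 : X s' = x).symm

/-- A nonatomic probability space carries a uniformly distributed random variable. -/
theorem IsNonatomic.exists_uniform (hP : IsNonatomic P) :
    ∃ U : S → ℝ, Measurable U ∧ P.map U = volume.restrict (Set.Ioo (0 : ℝ) 1) := by
  obtain ⟨X, hX, hX0⟩ := hP.exists_diffuse
  have := Measure.isProbabilityMeasure_map (μ := P) hX.aemeasurable
  have hm := (monotone_cdf (P.map X)).measurable
  refine ⟨fun s => cdf (P.map X) (X s), hm.comp hX, ?_⟩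
  rw [← map_cdf (P.map X) fun x => by
    rw [Measure.map_apply hX (measurableSet_singleton x), hX0], Measure.map_map hm hX]
  rfl

end Nonatomic

/-! ### Averages over equal cells of the unit interval. -/

section CellAverages

/-- The grid points that divide the unit interval into `n + 1` equal cells. -/
noncomputable def node (n i : ℕ) : ℝ := (i : ℝ) / ((n : ℝ) + 1)

/-- The index of the cell of the unit interval that contains `u`. -/
noncomputable def cell (n : ℕ) (u : ℝ) : Fin (n + 1) := Fin.ofNat (n + 1) ⌊((n : ℝ) + 1) * u⌋₊

/-- The average of `q` over the cell with index `i`. -/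
noncomputable def cellAverage (n : ℕ) (q : ℝ → ℝ) (i : ℕ) : ℝ :=
  ((n : ℝ) + 1) * ∫ u in node n i..node n (i + 1), q u

variable {n : ℕ}

theorem node_zero : node n 0 = 0 := by simp [node]

theorem node_last : node n (n + 1) = 1 := by
  simp only [node]
  push_cast
  exact div_self (by positivity)

theorem node_le {i j : ℕ} (h : i ≤ j) : node n i ≤ node n j := by
  unfold node
  gcongr

theorem node_lt {i j : ℕ} (h : i < j) : node n i < node n j := by
  unfold node
  gcongr

theorem node_succ_sub (i : ℕ) : node n (i + 1) - node n i = 1 / ((n : ℝ) + 1) := by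
  unfold node
  push_cast
  ring

theorem node_nonneg (i : ℕ) : 0 ≤ node n i := by
  unfold node
  positivity

theorem node_le_one {i : ℕ} (h : i ≤ n + 1) : node n i ≤ 1 :=
  (node_le h).trans_eq node_last

theorem cell_eq_iff {u : ℝ} (hu : u ∈ Set.Ico (0 : ℝ) 1) (i : Fin (n + 1)) :
    cell n u = i ↔ u ∈ Set.Ico (node n i) (node n (i + 1)) := by
  have hn : (0 : ℝ) < n + 1 := by positivity
  have h0 : 0 ≤ ((n : ℝ) + 1) * u := mul_nonneg hn.le hu.1
  -- For `u < 1` the reduction modulo `n + 1` inside `Fin.ofNat` has no effect.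
  have hlt : ⌊((n : ℝ) + 1) * u⌋₊ < n + 1 := by
    rw [Nat.floor_lt h0]
    push_cast
    nlinarith [hu.2]
  rw [Fin.ext_iff, cell, Fin.val_ofNat, Nat.mod_eq_of_lt hlt, Nat.floor_eq_iff h0, Set.mem_Ico,
    node, node, div_le_iff₀ hn, lt_div_iff₀ hn, mul_comm u]
  push_cast
  rfl

theorem measurable_cell : Measurable (cell n) :=
  measurable_from_nat.comp (Nat.measurable_floor.comp (measurable_const_mul _))

theorem volume_cell (i : Fin (n + 1)) :
    volume.restrict (Set.Ioo (0 : ℝ) 1) (cell n ⁻¹' {i}) = ENNReal.ofReal (1 / ((n : ℝ) + 1)) := by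
  have h : cell n ⁻¹' {i} ∩ Set.Ico 0 1 = Set.Ico (node n i) (node n (i + 1)) := by
    ext u
    constructor
    · rintro ⟨h1, h2⟩
      exact (cell_eq_iff h2 i).1 h1
    · intro hu
      have h2 : u ∈ Set.Ico (0 : ℝ) 1 :=
        ⟨(node_nonneg _).trans hu.1, hu.2.trans_le (node_le_one i.2)⟩
      exact ⟨(cell_eq_iff h2 i).2 hu, h2⟩
  rw [Measure.restrict_apply (measurable_cell (measurableSet_singleton i)),
    measure_congr (ae_eq_rfl.inter Ioo_ae_eq_Ico), h, Real.volume_Ico, node_succ_sub]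

variable {q : ℝ → ℝ}

theorem intervalIntegrable_sub {a b : ℝ} (hq : IntervalIntegrable q volume 0 1)
    (ha : a ∈ Set.Icc (0 : ℝ) 1) (hb : b ∈ Set.Icc (0 : ℝ) 1) :
    IntervalIntegrable q volume a b := by
  refine hq.mono_set (Set.uIcc_subset_uIcc ?_ ?_) <;> rwa [Set.uIcc_of_le zero_le_one]

theorem node_mem {i : ℕ} (h : i ≤ n + 1) : node n i ∈ Set.Icc (0 : ℝ) 1 :=
  ⟨node_nonneg i, node_le_one h⟩

theorem intervalIntegrable_cell (hq : IntervalIntegrable q volume 0 1) {i : ℕ} (hi : i < n + 1) :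
    IntervalIntegrable q volume (node n i) (node n (i + 1)) :=
  intervalIntegrable_sub hq (node_mem hi.le) (node_mem hi)

theorem sum_integral_cell (hq : IntervalIntegrable q volume 0 1) {m : ℕ} (hm : m ≤ n + 1) :
    ∑ i ∈ Finset.range m, ∫ u in node n i..node n (i + 1), q u = ∫ u in (0 : ℝ)..node n m, q u := by
  rw [intervalIntegral.sum_integral_adjacent_intervals (a := node n)
    fun i hi => intervalIntegrable_cell hq (hi.trans_le hm), node_zero]

theorem sum_Iic_cellAverage (hq : IntervalIntegrable q volume 0 1) (m : Fin (n + 1)) :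
    ∑ l ∈ Finset.Iic m, cellAverage n q l =
      ((n : ℝ) + 1) * ∫ u in (0 : ℝ)..node n (m + 1), q u := by
  rw [← sum_integral_cell hq m.2, Finset.mul_sum]
  refine Finset.sum_nbij (fun l => (l : ℕ)) ?_ ?_ ?_ fun _ _ => rfl
  · intro l hl
    have := Fin.le_def.1 (Finset.mem_Iic.1 hl)
    simpa using Nat.lt_succ_of_le this
  · exact fun a _ b _ h => Fin.ext h
  · intro l hl
    have hl' : l < m + 1 := by simpa using hl
    exact ⟨⟨l, by omega⟩, by simpa [Fin.le_def] using Nat.le_of_lt_succ hl', rfl⟩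

/-- Translating one cell onto a later one compares the integrands pointwise on the open cell. -/
theorem cellAverage_mono (hq : IntervalIntegrable q volume 0 1)
    (hmono : MonotoneOn q (Set.Ioo 0 1)) :
    Monotone fun i : Fin (n + 1) => cellAverage n q i := by
  intro i j hij
  have hij' : (i : ℕ) ≤ j := hij
  simp only [cellAverage]
  gcongr ?_ * ?_
  have h1 : node n i + (node n j - node n i) = node n j := add_sub_cancel _ _
  have h2 : node n (i + 1) + (node n j - node n i) = node n (j + 1) := by
    unfold node
    push_cast
    ring
  have hcomp := intervalIntegral.integral_comp_add_right (a := node n i) (b := node n (i + 1)) q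
    (node n j - node n i)
  rw [h1, h2] at hcomp
  rw [← hcomp]
  have hd : 0 ≤ node n j - node n i := sub_nonneg.2 (node_le hij')
  refine intervalIntegral.integral_mono_on_of_le_Ioo (node_le (Nat.le_succ _))
    (intervalIntegrable_cell hq i.2) ?_ fun u hu => ?_
  · have := (intervalIntegrable_cell hq j.2).comp_add_right (node n j - node n i)
    rwa [← eq_sub_of_add_eq h1, ← eq_sub_of_add_eq h2] at this
  · have hlast : node n (j + 1) ≤ 1 := node_le_one j.2
    have h0 : 0 ≤ node n i := node_nonneg i
    exact hmono ⟨by linarith [hu.1], by linarith [hu.2]⟩ ⟨by linarith [hu.1], by linarith [hu.2]⟩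
      (by linarith)

theorem abs_cellAverage_le {M : ℝ}
    (hM : ∀ᵐ u ∂(volume.restrict (Set.Ioo (0 : ℝ) 1)), |q u| ≤ M) {i : ℕ} (hi : i < n + 1) :
    |cellAverage n q i| ≤ M := by
  rw [restrict_Ioo_eq_restrict_Ioc, ae_restrict_iff' measurableSet_Ioc] at hM
  have hn : (0 : ℝ) < n + 1 := by positivity
  have h := intervalIntegral.norm_integral_le_of_norm_le_const_ae (a := node n i)
    (b := node n (i + 1)) (C := M) (f := q) (by
      filter_upwards [hM] with u hu hu'
      rw [Set.uIoc_of_le (node_le (Nat.le_succ _))] at hu'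
      exact hu ⟨(node_nonneg i).trans_lt hu'.1, hu'.2.trans (node_le_one hi)⟩)
  rw [node_succ_sub, abs_of_pos (by positivity), Real.norm_eq_abs] at h
  rw [cellAverage, abs_mul, abs_of_pos hn]
  calc ((n : ℝ) + 1) * |∫ u in node n i..node n (i + 1), q u|
      ≤ ((n : ℝ) + 1) * (M * (1 / ((n : ℝ) + 1))) := by gcongr
    _ = M := by field_simp

theorem tendsto_cellAverage (hq : IntervalIntegrable q volume 0 1) {u : ℝ}
    (hu : u ∈ Set.Ioo (0 : ℝ) 1) (hc : ContinuousAt q u) :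
    Tendsto (fun n => cellAverage n q (cell n u)) atTop (𝓝 (q u)) := by
  rw [Metric.tendsto_atTop]
  intro ε hε
  obtain ⟨δ, hδ, hball⟩ := Metric.continuousAt_iff.1 hc (ε / 2) (by positivity)
  obtain ⟨N, hN⟩ := exists_nat_one_div_lt hδ
  refine ⟨N, fun n hn => ?_⟩
  have hn0 : (0 : ℝ) < n + 1 := by positivity
  have hnδ : 1 / ((n : ℝ) + 1) < δ := lt_of_le_of_lt (by gcongr) hN
  set i := cell n u with hi
  have hmem := (cell_eq_iff (Set.Ioo_subset_Ico_self hu) i).1 hi.symm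
  have hsub := node_succ_sub (n := n) i
  have hdiff : cellAverage n q i - q u =
      ((n : ℝ) + 1) * ∫ v in node n i..node n (i + 1), (q v - q u) := by
    rw [intervalIntegral.integral_sub (intervalIntegrable_cell hq i.2) intervalIntegrable_const,
      intervalIntegral.integral_const, hsub, cellAverage, smul_eq_mul]
    field_simp
  have h := intervalIntegral.norm_integral_le_of_norm_le_const (a := node n i)
    (b := node n (i + 1)) (C := ε / 2) (f := fun v => q v - q u) (by
      intro v hv
      rw [Set.uIoc_of_le (node_le (Nat.le_succ _))] at hv
      rw [← dist_eq_norm]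
      refine (hball ?_).le
      rw [Real.dist_eq, abs_lt]
      constructor <;> linarith [hv.1, hv.2, hmem.1, hmem.2])
  rw [hsub, abs_of_pos (by positivity), Real.norm_eq_abs] at h
  rw [Real.dist_eq, hdiff, abs_mul, abs_of_pos hn0]
  calc ((n : ℝ) + 1) * |∫ v in node n i..node n (i + 1), (q v - q u)|
      ≤ ((n : ℝ) + 1) * (ε / 2 * (1 / ((n : ℝ) + 1))) := by gcongr
    _ = ε / 2 := by field_simp
    _ < ε := half_lt_self hε

/-- Jensen's inequality for `|x| ^ p` on a single cell. -/
theorem abs_cellAverage_pow_le {p : ℕ} (hq : IntervalIntegrable q volume 0 1)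
    (hqp : IntervalIntegrable (fun u => |q u| ^ p) volume 0 1) {i : ℕ} (hi : i < n + 1) :
    |cellAverage n q i| ^ p ≤ cellAverage n (fun u => |q u| ^ p) i := by
  have hlt : node n i < node n (i + 1) := node_lt (Nat.lt_succ_self i)
  have havg : ∀ h : ℝ → ℝ, ⨍ u in Set.Ioc (node n i) (node n (i + 1)), h u = cellAverage n h i := by
    intro h
    rw [setAverage_eq, Real.volume_real_Ioc_of_le hlt.le, node_succ_sub, cellAverage,
      intervalIntegral.integral_of_le hlt.le, one_div, inv_inv, smul_eq_mul]
  have hconv : ConvexOn ℝ Set.univ fun x : ℝ => |x| ^ p :=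
    (convexOn_norm convex_univ).pow (fun _ _ => norm_nonneg _) p
  have h := hconv.map_set_average_le (μ := volume) (t := Set.Ioc (node n i) (node n (i + 1)))
    (f := q) (by fun_prop) isClosed_univ (by simpa using hlt) (by simp) (by simp)
    ((intervalIntegrable_iff_integrableOn_Ioc_of_le hlt.le).1 (intervalIntegrable_cell hq hi))
    ((intervalIntegrable_iff_integrableOn_Ioc_of_le hlt.le).1 (intervalIntegrable_cell hqp hi))
  rwa [havg, havg] at h

/-- Jensen summed over the cells; the bound is uniform in `n`, as needed for convergence of moments.
-/
theorem integral_abs_cellAverage_pow_le {p : ℕ} (hq : IntervalIntegrable q volume 0 1)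
    (hqp : IntervalIntegrable (fun u => |q u| ^ p) volume 0 1)
    (hstep : IntervalIntegrable (fun u => |cellAverage n q (cell n u)| ^ p) volume 0 1) :
    ∫ u in (0 : ℝ)..1, |cellAverage n q (cell n u)| ^ p ≤ ∫ u in (0 : ℝ)..1, |q u| ^ p := by
  have h1 := sum_integral_cell hqp (le_refl (n + 1))
  have h2 := sum_integral_cell hstep (le_refl (n + 1))
  rw [node_last] at h1 h2
  rw [← h1, ← h2]
  refine Finset.sum_le_sum fun i hi => ?_
  have hi' : i < n + 1 := Finset.mem_range.1 hi
  have hn : (0 : ℝ) < n + 1 := by positivity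
  have hconst : ∫ u in node n i..node n (i + 1), |cellAverage n q (cell n u)| ^ p =
      ∫ _u in node n i..node n (i + 1), |cellAverage n q i| ^ p := by
    refine intervalIntegral.integral_congr_Ioo_of_le (node_le (Nat.le_succ i)) fun u hu => ?_
    have hu' : u ∈ Set.Ico (0 : ℝ) 1 :=
      ⟨(node_nonneg i).trans hu.1.le, hu.2.trans_le (node_le_one hi')⟩
    have hc := (cell_eq_iff hu' ⟨i, hi'⟩).2 (Set.Ioo_subset_Ico_self hu)
    simp only [hc]
  rw [hconst, intervalIntegral.integral_const, node_succ_sub, smul_eq_mul, one_div,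
    inv_mul_le_iff₀ hn]
  exact abs_cellAverage_pow_le hq hqp hi'

end CellAverages

/-! ### Test functions for the concave order. -/

section ConcaveOrder

variable {S : Type*} [MeasurableSpace S] {P : Measure S} [IsProbabilityMeasure P]
  {k : PayoffClass}

theorem ConcaveGE.integral_le {f g : Payoff P k} (h : ConcaveGE f g) {φ : ℝ → ℝ}
    (hφ : ConcaveOn ℝ Set.univ φ) (hf : Integrable (fun s => φ ((f : S → ℝ) s)) P)
    (hg : Integrable (fun s => φ ((g : S → ℝ) s)) P) :
    ∫ s, φ ((g : S → ℝ) s) ∂P ≤ ∫ s, φ ((f : S → ℝ) s) ∂P := by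
  have := h φ hφ
  rwa [extExpectation_of_integrable hf, extExpectation_of_integrable hg,
    EReal.coe_le_coe_iff] at this

theorem ConcaveGE.integral_eq {f g : Payoff P k} (h : ConcaveGE f g) :
    ∫ s, (g : S → ℝ) s ∂P = ∫ s, (f : S → ℝ) s ∂P := by
  refine le_antisymm (h.integral_le (concaveOn_id convex_univ) f.integrable g.integrable) ?_
  have := h.integral_le (φ := fun x => -x) (convexOn_id convex_univ).neg f.integrable.neg
    g.integrable.neg
  simp only [integral_neg, neg_le_neg_iff] at this
  exact this

/-- These test functions and the equality of means are all that the way back to (i) uses of the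
concave order. -/
theorem ConcaveGE.integral_min_le {f g : Payoff P k} (h : ConcaveGE f g) (t : ℝ) :
    ∫ s, min ((g : S → ℝ) s - t) 0 ∂P ≤ ∫ s, min ((f : S → ℝ) s - t) 0 ∂P := by
  have hint : ∀ u : Payoff P k, Integrable (fun s => min ((u : S → ℝ) s - t) 0) P := fun u =>
    (u.integrable.sub (integrable_const t)).inf (integrable_zero _ _ _)
  exact h.integral_le (φ := fun x => min (x - t) 0)
    (((concaveOn_id convex_univ).sub (convexOn_const t convex_univ)).inf
      (concaveOn_const 0 convex_univ)) (hint f) (hint g)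

end ConcaveOrder

/-! ### Spaces generated by a finite uniform partition. -/

section FiniteSpace

variable {S : Type*} [MeasurableSpace S] {P : Measure S} [IsProbabilityMeasure P]
  {k : PayoffClass} {N : ℕ}

theorem IsUniformLabel.exists_integral_eq {κ : S → Fin N} (hκ : IsUniformLabel P κ) :
    ∃ c : ℝ, 0 < c ∧ ∀ x : Fin N → ℝ, ∫ s, x (κ s) ∂P = c * ∑ i, x i := by
  obtain ⟨s₀⟩ : Nonempty S := nonempty_of_isProbabilityMeasure P
  have hmap := Measure.isProbabilityMeasure_map (μ := P) hκ.measurable.aemeasurable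
  have key : ∀ x : Fin N → ℝ, ∫ s, x (κ s) ∂P = P.real (κ ⁻¹' {κ s₀}) * ∑ i, x i := by
    intro x
    rw [← integral_map hκ.measurable.aemeasurable (f := x)
      (measurable_of_finite x).aestronglyMeasurable,
      integral_fintype (Integrable.of_finite), Finset.mul_sum]
    refine Finset.sum_congr rfl fun i _ => ?_
    rw [measureReal_def, Measure.map_apply hκ.measurable (measurableSet_singleton i),
      hκ.measure_eq i (κ s₀), smul_eq_mul, measureReal_def]
  refine ⟨_, lt_of_le_of_ne measureReal_nonneg fun h0 => ?_, key⟩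
  have := key 1
  rw [← h0] at this
  simp at this

theorem IsUniformOnFinitePartition.exists_label (hP : IsUniformOnFinitePartition P) :
    ∃ (N : ℕ) (κ : S → Fin N), IsUniformLabel P κ ∧
      ∀ f : S → ℝ, Measurable f → ∃ x : Fin N → ℝ, f = x ∘ κ := by
  obtain ⟨n, C, hdisj, hcov, hgen, hmeas⟩ := hP
  have hcov' : ∀ s, ∃ i, s ∈ C i := fun s => by
    simpa using (Set.mem_iUnion.1 (hcov ▸ Set.mem_univ s))
  choose κ hκ using hcov'
  have hpre : ∀ i, κ ⁻¹' {i} = C i := by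
    intro i
    ext s
    constructor
    · rintro rfl
      exact hκ s
    · intro hs
      by_contra hne
      exact Set.disjoint_left.1 (hdisj hne) (hκ s) hs
  have hCm : ∀ i, MeasurableSet (C i) := by
    intro i
    rw [hgen]
    exact MeasurableSpace.measurableSet_generateFrom ⟨i, rfl⟩
  -- No measurable set separates two states of one cell, so measurable functions factor through the
  -- label.
  have hsep : ∀ E : Set S, MeasurableSet E → ∀ s t, κ s = κ t → (s ∈ E ↔ t ∈ E) := by
    intro E hE
    rw [hgen] at hE
    induction E, hE using MeasurableSpace.generateFrom_induction with
    | hC E hE _ =>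
      obtain ⟨i, rfl⟩ := hE
      intro s t hst
      rw [← hpre i]
      simp [hst]
    | empty => simp
    | compl E _ ih => exact fun s t hst => not_congr (ih s t hst)
    | iUnion E _ ih =>
      intro s t hst
      simp only [Set.mem_iUnion]
      exact exists_congr fun i => ih i s t hst
  refine ⟨n, κ, ⟨measurable_to_countable' fun i => hpre i ▸ hCm i, fun i j => ?_⟩,
    fun f hf => ?_⟩
  · rw [hpre, hpre, hmeas, hmeas]
  · have hfac : Function.FactorsThrough f κ := fun s t hst =>
      ((hsep _ (hf (measurableSet_singleton (f t))) s t hst).2 rfl)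
    exact ⟨Function.extend κ f (0 : Fin n → ℝ), (hfac.extend_comp (0 : Fin n → ℝ)).symm⟩

theorem RiskPreference.TransfersRegressive.transfersRanking_label {A B : RiskPreference P k}
    (h : A.TransfersRegressive B) (hAm : A.IsMonotone) (hAs : A.IsSecular) (hBm : B.IsMonotone)
    {κ : S → Fin N} (hκ : IsUniformLabel P κ) {x y : Fin N → ℝ}
    (hxy : ConcaveGE (labelPayoff P k hκ.measurable x) (labelPayoff P k hκ.measurable y)) :
    A.TransfersRanking B (labelPayoff P k hκ.measurable x)
      (labelPayoff P k hκ.measurable y) := by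
  obtain ⟨c, hc, hint⟩ := hκ.exists_integral_eq
  set x' := x ∘ Tuple.sort x with hx'
  set y' := y ∘ Tuple.sort y with hy'
  have hxm : Monotone x' := Tuple.monotone_sort x
  have hym : Monotone y' := Tuple.monotone_sort y
  have hxs : ∀ φ : ℝ → ℝ, ∑ l, φ (x' l) = ∑ l, φ (x l) := fun φ =>
    Equiv.sum_comp (Tuple.sort x) fun l => φ (x l)
  have hys : ∀ φ : ℝ → ℝ, ∑ l, φ (y' l) = ∑ l, φ (y l) := fun φ =>
    Equiv.sum_comp (Tuple.sort y) fun l => φ (y l)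
  refine TransfersRanking.congr_eqDist (h.transfersRanking_of_prefix hAm hAs hBm hκ hxm y' ?_ ?_)
    (hκ.eqDist_perm x _) (hκ.eqDist_perm y _)
  · have h1 := hxy.integral_eq
    simp only [labelPayoff_apply] at h1
    rw [hint, hint] at h1
    exact (hys id).trans ((mul_left_cancel₀ hc.ne' h1).trans (hxs id).symm)
  · intro m
    -- With threshold `y' m`, the truncated sum of the sorted `y'` equals its partial sum up to `m`
    -- of differences from the threshold, while that of `x'` is at most its own. Comparing them
    -- gives the partial sum inequality.
    have h1 := hxy.integral_min_le (y' m)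
    simp only [labelPayoff_apply] at h1
    rw [hint fun l => min (y l - y' m) 0, hint fun l => min (x l - y' m) 0] at h1
    have h2 := le_of_mul_le_mul_left h1 hc
    rw [← hys fun v => min (v - y' m) 0, ← hxs fun v => min (v - y' m) 0] at h2
    have h3 : ∑ l, min (x' l - y' m) 0 ≤ ∑ l ∈ Finset.Iic m, (x' l - y' m) := by
      rw [← Finset.sum_add_sum_compl (Finset.Iic m)]
      have h4 : ∑ l ∈ (Finset.Iic m)ᶜ, min (x' l - y' m) 0 ≤ 0 :=
        Finset.sum_nonpos fun l _ => min_le_right _ _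
      have h5 : ∑ l ∈ Finset.Iic m, min (x' l - y' m) 0 ≤ ∑ l ∈ Finset.Iic m, (x' l - y' m) :=
        Finset.sum_le_sum fun l _ => min_le_left _ _
      linarith
    have h4 : ∑ l, min (y' l - y' m) 0 = ∑ l ∈ Finset.Iic m, (y' l - y' m) := by
      rw [← Finset.sum_add_sum_compl (Finset.Iic m), Finset.sum_eq_zero
        (s := (Finset.Iic m)ᶜ) fun l hl => ?_, add_zero]
      · refine Finset.sum_congr rfl fun l hl => min_eq_left ?_
        exact sub_nonpos.2 (hym (Finset.mem_Iic.1 hl))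
      · have hl' : m < l := by simpa using hl
        exact min_eq_right (sub_nonneg.2 (hym hl'.le))
    rw [Finset.sum_sub_distrib] at h3 h4
    linarith

end FiniteSpace

/-! ### Nonatomic spaces: rearrangement, averaging and passage to the limit. -/

section NonatomicSpace

variable {S : Type*} [MeasurableSpace S] {P : Measure S} [IsProbabilityMeasure P]
  {k : PayoffClass}

/-- A random variable with uniform distribution on the unit interval. -/
structure IsUniform (P : Measure S) (U : S → ℝ) : Prop where
  measurable : Measurable U
  map_eq : P.map U = volume.restrict (Set.Ioo (0 : ℝ) 1)

variable {U : S → ℝ}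

theorem IsUniform.integrable_comp_iff (hU : IsUniform P U) {h : ℝ → ℝ} (hh : Measurable h) :
    Integrable (fun s => h (U s)) P ↔ IntervalIntegrable h volume 0 1 := by
  have := integrable_map_measure (μ := P) (f := U) (g := h) hh.aestronglyMeasurable
    hU.measurable.aemeasurable
  rw [hU.map_eq] at this
  rw [intervalIntegrable_iff_integrableOn_Ioo_of_le zero_le_one]
  exact this.symm

theorem IsUniform.integral_comp (hU : IsUniform P U) {h : ℝ → ℝ} (hh : Measurable h) :
    ∫ s, h (U s) ∂P = ∫ u in (0 : ℝ)..1, h u := by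
  rw [intervalIntegral.integral_of_le zero_le_one, integral_Ioc_eq_integral_Ioo, ← hU.map_eq,
    integral_map hU.measurable.aemeasurable hh.aestronglyMeasurable]

theorem IsUniform.ae_comp_iff (hU : IsUniform P U) {p : ℝ → Prop} (hp : MeasurableSet {u | p u}) :
    (∀ᵐ s ∂P, p (U s)) ↔ ∀ᵐ u ∂(volume.restrict (Set.Ioo (0 : ℝ) 1)), p u := by
  rw [← hU.map_eq, ae_map_iff hU.measurable.aemeasurable hp]

theorem IsUniform.isUniformLabel (hU : IsUniform P U) (n : ℕ) :
    IsUniformLabel P fun s => cell n (U s) := by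
  refine ⟨measurable_cell.comp hU.measurable, ?_⟩
  have key : ∀ i, P ((fun s => cell n (U s)) ⁻¹' {i}) = ENNReal.ofReal (1 / ((n : ℝ) + 1)) := by
    intro i
    rw [← volume_cell, ← hU.map_eq,
      Measure.map_apply hU.measurable (measurable_cell (measurableSet_singleton i))]
    rfl
  intro i j
  rw [key, key]

theorem admits_of_map_eq {f g : S → ℝ} (hf : Measurable f) (hg : Measurable g)
    (h : P.map f = P.map g) (hadm : k.Admits P f) : k.Admits P g := by
  have key : ∀ p : ℝ≥0∞, MemLp f p P → MemLp g p P := by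
    intro p hp
    have h1 := memLp_map_measure_iff (μ := P) (p := p) (f := f) (g := id)
      aestronglyMeasurable_id hf.aemeasurable
    have h2 := memLp_map_measure_iff (μ := P) (p := p) (f := g) (g := id)
      aestronglyMeasurable_id hg.aemeasurable
    exact h2.1 (h ▸ h1.2 hp)
  cases k with
  | bounded => exact key ∞ hadm
  | allMoments => exact fun p => key p (hadm p)

theorem IsUniform.map_quantile (hU : IsUniform P U) (f : Payoff P k) :
    P.map (fun s => quantile (P.map (f : S → ℝ)) (U s)) = P.map (f : S → ℝ) := by
  have := Measure.isProbabilityMeasure_map (μ := P) (f := (f : S → ℝ)) f.2.1.aemeasurable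
  have h := Measure.map_map (μ := P) (measurable_quantile (P.map (f : S → ℝ))) hU.measurable
  rw [hU.map_eq, InsuranceRisk.map_quantile] at h
  exact h.symm

/-- The increasing rearrangement of a payoff along a uniform random variable. -/
noncomputable def rearrangement (hU : IsUniform P U) (f : Payoff P k) : Payoff P k :=
  ⟨fun s => quantile (P.map (f : S → ℝ)) (U s), (measurable_quantile _).comp hU.measurable,
    admits_of_map_eq f.2.1 ((measurable_quantile _).comp hU.measurable)
      (hU.map_quantile f).symm f.2.2⟩

theorem eqDist_rearrangement (hU : IsUniform P U) (f : Payoff P k) :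
    EqDist (rearrangement hU f) f :=
  hU.map_quantile f

theorem intervalIntegrable_quantile (hU : IsUniform P U) (f : Payoff P k) :
    IntervalIntegrable (quantile (P.map (f : S → ℝ))) volume 0 1 :=
  (hU.integrable_comp_iff (measurable_quantile _)).1 (rearrangement hU f).integrable

/-- Bounded higher moments turn almost sure convergence to zero into convergence of moments. -/
theorem tendsto_integral_pow_of_moment_le {h : ℕ → S → ℝ} {p : ℕ} (hp : 1 ≤ p) {C : ℝ}
    (hm : ∀ n, Measurable (h n)) (h0 : ∀ n s, 0 ≤ h n s)
    (hlim : ∀ᵐ s ∂P, Tendsto (fun n => h n s) atTop (𝓝 0))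
    (hint : ∀ n, Integrable (fun s => h n s ^ (p + 1)) P)
    (hC : ∀ n, ∫ s, h n s ^ (p + 1) ∂P ≤ C) :
    Tendsto (fun n => ∫ s, h n s ^ p ∂P) atTop (𝓝 0) := by
  have hC0 : 0 ≤ C := (integral_nonneg fun s => pow_nonneg (h0 0 s) _).trans (hC 0)
  have htrunc : ∀ K : ℝ, 0 < K →
      Tendsto (fun n => ∫ s, min (h n s) K ^ p ∂P) atTop (𝓝 0) := by
    intro K hK
    have key : Tendsto (fun n => ∫ s, min (h n s) K ^ p ∂P) atTop (𝓝 (∫ _, (0 : ℝ) ∂P)) := by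
      refine tendsto_integral_of_dominated_convergence (fun _ => K ^ p)
        (fun n => (((hm n).min measurable_const).pow_const p).aestronglyMeasurable)
        (integrable_const _) (fun n => ae_of_all _ fun s => ?_) ?_
      · have : 0 ≤ min (h n s) K := le_min (h0 n s) hK.le
        rw [Real.norm_of_nonneg (by positivity)]
        gcongr
        exact min_le_right _ _
      · filter_upwards [hlim] with s hs
        have := (hs.min (tendsto_const_nhds (x := K))).pow p
        rwa [min_eq_left hK.le, zero_pow (by omega)] at this
    simpa using key
  rw [Metric.tendsto_atTop]
  intro ε hε
  -- From `h ^ p ≤ min h K ^ p + h ^ (p + 1) / K`, the tail costs at most `C / K < ε / 2`; using `C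
  -- + 1` keeps `K` positive when `C = 0`.
  set K := 2 * (C + 1) / ε with hKdef
  have hK : 0 < K := by positivity
  obtain ⟨N, hN⟩ := Metric.tendsto_atTop.1 (htrunc K hK) (ε / 2) (by positivity)
  refine ⟨N, fun n hn => ?_⟩
  have h1 := hN n hn
  rw [Real.dist_0_eq_abs, abs_lt] at h1
  have hmin : Integrable (fun s => min (h n s) K ^ p) P := by
    refine Integrable.of_bound
      (((hm n).min measurable_const).pow_const p).aestronglyMeasurable (K ^ p)
      (ae_of_all _ fun s => ?_)
    have : 0 ≤ min (h n s) K := le_min (h0 n s) hK.le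
    rw [Real.norm_of_nonneg (by positivity)]
    gcongr
    exact min_le_right _ _
  have h2 : ∫ s, h n s ^ p ∂P ≤ ∫ s, (min (h n s) K ^ p + K⁻¹ * h n s ^ (p + 1)) ∂P := by
    refine integral_mono_of_nonneg (ae_of_all _ fun s => pow_nonneg (h0 n s) _)
      (hmin.add ((hint n).const_mul _)) (ae_of_all _ fun s => ?_)
    have hs := h0 n s
    rcases le_total (h n s) K with hle | hle
    · simp only [min_eq_left hle]
      have : 0 ≤ K⁻¹ * h n s ^ (p + 1) := by positivity
      linarith
    · simp only [min_eq_right hle]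
      have h3 : h n s ^ p ≤ K⁻¹ * h n s ^ (p + 1) := by
        rw [pow_succ, inv_mul_eq_div, le_div_iff₀ hK]
        gcongr
      have : 0 ≤ K ^ p := by positivity
      linarith
  rw [integral_add hmin ((hint n).const_mul _), integral_const_mul] at h2
  have h3 : K⁻¹ * ∫ s, h n s ^ (p + 1) ∂P < ε / 2 := by
    calc K⁻¹ * ∫ s, h n s ^ (p + 1) ∂P ≤ K⁻¹ * C := by
          gcongr
          exact hC n
      _ < K⁻¹ * (C + 1) := by gcongr; linarith
      _ = ε / 2 := by
          rw [hKdef]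
          field_simp
  rw [Real.dist_0_eq_abs, abs_of_nonneg (integral_nonneg fun s => pow_nonneg (h0 n s) _)]
  linarith [h1.2]

/-- The rearrangement is the limit of its averages over ever finer uniform partitions. -/
theorem converges_cellAverage (hU : IsUniform P U) (f : Payoff P k) :
    Converges (fun n => labelPayoff P k (hU.isUniformLabel n).measurable
      fun i => cellAverage n (quantile (P.map (f : S → ℝ))) i) (rearrangement hU f) := by
  set q := quantile (P.map (f : S → ℝ)) with hq
  have hqm : Measurable q := measurable_quantile _
  have hqi : IntervalIntegrable q volume 0 1 := intervalIntegrable_quantile hU f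
  have hcont : ∀ᵐ u ∂(volume.restrict (Set.Ioo (0 : ℝ) 1)),
      Tendsto (fun n => cellAverage n q (cell n u)) atTop (𝓝 (q u)) := by
    -- The averages converge at every continuity point, and a monotone quantile function has only
    -- countably many others.
    have hc := (monotoneOn_quantile (P.map (f : S → ℝ))).countable_not_continuousWithinAt
    filter_upwards [ae_restrict_mem measurableSet_Ioo, hc.ae_notMem _] with u hu hu'
    refine tendsto_cellAverage hqi hu ?_
    by_contra hcon
    exact hu' ⟨hu, fun hw => hcon (hw.continuousAt (isOpen_Ioo.mem_nhds hu))⟩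
  have hlim : ∀ᵐ s ∂P, Tendsto (fun n => cellAverage n q (cell n (U s))) atTop (𝓝 (q (U s))) := by
    rw [← hU.map_eq] at hcont
    exact ae_of_ae_map hU.measurable.aemeasurable hcont
  cases k with
  | bounded =>
    obtain ⟨M, hM⟩ := ae_abs_le_of_memLp_top (rearrangement hU f).2.2
    have hM' := (hU.ae_comp_iff (p := fun u => |q u| ≤ M)
      (measurableSet_le hqm.abs measurable_const)).1 hM
    exact ⟨⟨M, fun n => ae_of_all _ fun s => abs_cellAverage_le hM' (cell n (U s)).2⟩, hlim⟩
  | allMoments =>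
    intro p hp
    have hstep : ∀ n, Measurable fun u => cellAverage n q (cell n u) := fun n =>
      (measurable_of_finite fun i : Fin (n + 1) => cellAverage n q i).comp measurable_cell
    have hpow : ∀ u : Payoff P .allMoments,
        Integrable (fun s => |(u : S → ℝ) s| ^ (p + 1)) P := fun u =>
      (u.2.2 (p + 1)).integrable_norm_pow (by omega)
    refine tendsto_integral_pow_of_moment_le (P := P) hp
      (h := fun n s => |cellAverage n q (cell n (U s)) - q (U s)|)
      -- The factor `2 ^ p` comes from convexity of the power `p + 1`, the factor `2` from bounding
      -- the step function's moment by that of `q`.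
      (C := 2 ^ p * (2 * ∫ u in (0 : ℝ)..1, |q u| ^ (p + 1)))
      (fun n => (((hstep n).sub hqm).comp hU.measurable).abs) (fun n s => abs_nonneg _) ?_ ?_ ?_
    · filter_upwards [hlim] with s hs
      simpa using (hs.sub_const (q (U s))).abs
    · exact fun n => hpow (labelPayoff P .allMoments (hU.isUniformLabel n).measurable
        (fun i => cellAverage n q i) - rearrangement hU f)
    · intro n
      have hA : Integrable (fun s => |cellAverage n q (cell n (U s))| ^ (p + 1)) P :=
        hpow (labelPayoff P .allMoments (hU.isUniformLabel n).measurable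
          fun i => cellAverage n q i)
      have hB : Integrable (fun s => |q (U s)| ^ (p + 1)) P := hpow (rearrangement hU f)
      have h1 : ∫ s, |cellAverage n q (cell n (U s)) - q (U s)| ^ (p + 1) ∂P ≤
          ∫ s, 2 ^ p * (|cellAverage n q (cell n (U s))| ^ (p + 1) + |q (U s)| ^ (p + 1)) ∂P := by
        refine integral_mono_of_nonneg (ae_of_all _ fun s => by positivity)
          ((hA.add hB).const_mul _) (ae_of_all _ fun s => ?_)
        refine le_trans (pow_le_pow_left₀ (abs_nonneg _) (abs_sub _ _) _) ?_
        exact add_pow_le (abs_nonneg _) (abs_nonneg _) (p + 1)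
      have hAm : Measurable fun u => |cellAverage n q (cell n u)| ^ (p + 1) :=
        (hstep n).abs.pow_const _
      have hBm : Measurable fun u => |q u| ^ (p + 1) := hqm.abs.pow_const _
      have h2 := integral_abs_cellAverage_pow_le (n := n) hqi
        ((hU.integrable_comp_iff hBm).1 hB) ((hU.integrable_comp_iff hAm).1 hA)
      rw [integral_const_mul, integral_add hA hB, hU.integral_comp hAm, hU.integral_comp hBm] at h1
      refine h1.trans ?_
      gcongr
      linarith

theorem integral_min_quantile (hU : IsUniform P U) (f : Payoff P k) (t : ℝ) :
    ∫ s, min ((f : S → ℝ) s - t) 0 ∂P =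
      ∫ u in (0 : ℝ)..1, min (quantile (P.map (f : S → ℝ)) u - t) 0 := by
  have hm : Measurable fun x : ℝ => min (x - t) 0 := by fun_prop
  refine Eq.trans ?_ (hU.integral_comp
    (h := fun u => min (quantile (P.map (f : S → ℝ)) u - t) 0) (hm.comp (measurable_quantile _)))
  have h1 := integral_map (μ := P) f.2.1.aemeasurable hm.aestronglyMeasurable
  have h2 := integral_map (μ := P) (rearrangement hU f).2.1.aemeasurable hm.aestronglyMeasurable
  rw [eqDist_rearrangement hU f] at h2
  exact h1.symm.trans h2

theorem integral_quantile (hU : IsUniform P U) (f : Payoff P k) :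
    ∫ s, (f : S → ℝ) s ∂P = ∫ u in (0 : ℝ)..1, quantile (P.map (f : S → ℝ)) u := by
  rw [← hU.integral_comp (measurable_quantile _)]
  exact (eqDist_rearrangement hU f).integral_eq.symm

/-- The continuous form of the partial sum argument, with the quantile of `g` at `a` as threshold.
The endpoint `a = 1` needs the equality of means, as `quantile` has only a default value there. -/
theorem ConcaveGE.integral_quantile_le (hU : IsUniform P U) {f g : Payoff P k}
    (h : ConcaveGE f g) {a : ℝ} (ha : a ∈ Set.Ioc (0 : ℝ) 1) :
    ∫ u in (0 : ℝ)..a, quantile (P.map (g : S → ℝ)) u ≤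
      ∫ u in (0 : ℝ)..a, quantile (P.map (f : S → ℝ)) u := by
  rcases ha.2.eq_or_lt with rfl | ha1
  · rw [← integral_quantile hU, ← integral_quantile hU, h.integral_eq]
  have haIoo : a ∈ Set.Ioo (0 : ℝ) 1 := ⟨ha.1, ha1⟩
  have hmono := monotoneOn_quantile (P.map (g : S → ℝ))
  set qf := quantile (P.map (f : S → ℝ))
  set qg := quantile (P.map (g : S → ℝ))
  set t := qg a
  have hf : IntervalIntegrable qf volume 0 1 := intervalIntegrable_quantile hU f
  have hg : IntervalIntegrable qg volume 0 1 := intervalIntegrable_quantile hU g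
  have h0 : (0 : ℝ) ∈ Set.Icc (0 : ℝ) 1 := by simp
  have h1 : (1 : ℝ) ∈ Set.Icc (0 : ℝ) 1 := by simp
  have ha' : a ∈ Set.Icc (0 : ℝ) 1 := ⟨ha.1.le, ha.2⟩
  have hmin : ∀ q : ℝ → ℝ, IntervalIntegrable q volume 0 1 →
      IntervalIntegrable (fun u => min (q u - t) 0) volume 0 1 := by
    intro q hq
    have := (hq.sub (intervalIntegrable_const (c := t)))
    exact ⟨this.1.inf (integrable_zero _ _ _), this.2.inf (integrable_zero _ _ _)⟩
  have key := h.integral_min_le t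
  rw [integral_min_quantile hU, integral_min_quantile hU,
    ← intervalIntegral.integral_add_adjacent_intervals
      (intervalIntegrable_sub (hmin qg hg) h0 ha') (intervalIntegrable_sub (hmin qg hg) ha' h1),
    ← intervalIntegral.integral_add_adjacent_intervals
      (intervalIntegrable_sub (hmin qf hf) h0 ha') (intervalIntegrable_sub (hmin qf hf) ha' h1)]
    at key
  have e1 : ∫ u in (0 : ℝ)..a, min (qg u - t) 0 = ∫ u in (0 : ℝ)..a, (qg u - t) := by
    refine intervalIntegral.integral_congr_Ioo_of_le ha.1.le fun u hu => min_eq_left ?_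
    exact sub_nonpos.2 (hmono ⟨hu.1, hu.2.trans ha1⟩ haIoo hu.2.le)
  have e2 : ∫ u in a..1, min (qg u - t) 0 = ∫ _u in a..1, (0 : ℝ) := by
    refine intervalIntegral.integral_congr_Ioo_of_le ha.2 fun u hu => min_eq_right ?_
    exact sub_nonneg.2 (hmono haIoo ⟨ha.1.trans hu.1, hu.2⟩ hu.1.le)
  have e3 : ∫ u in (0 : ℝ)..a, min (qf u - t) 0 ≤ ∫ u in (0 : ℝ)..a, (qf u - t) :=
    intervalIntegral.integral_mono_on_of_le_Ioo ha.1.le (intervalIntegrable_sub (hmin qf hf) h0 ha')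
      ((intervalIntegrable_sub hf h0 ha').sub intervalIntegrable_const)
      fun u _ => min_le_left _ _
  have e4 : ∫ u in a..1, min (qf u - t) 0 ≤ ∫ _u in a..1, (0 : ℝ) :=
    intervalIntegral.integral_mono_on_of_le_Ioo ha.2 (intervalIntegrable_sub (hmin qf hf) ha' h1)
      intervalIntegrable_const fun u _ => min_le_right _ _
  rw [intervalIntegral.integral_sub (intervalIntegrable_sub hg h0 ha')
    intervalIntegrable_const] at e1
  rw [intervalIntegral.integral_sub (intervalIntegrable_sub hf h0 ha')
    intervalIntegrable_const] at e3
  linarith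

/-- Partial sums of cell averages are multiples of integrals of the quantile function from `0` to a
grid point, so the averaged payoffs inherit the majorization; the limit returns to the laws of `f`
and `g`. -/
theorem RiskPreference.TransfersRegressive.transfersRanking_uniform {A B : RiskPreference P k}
    (h : A.TransfersRegressive B) (hAc : A.IsContinuous) (hAm : A.IsMonotone)
    (hAs : A.IsSecular) (hBc : B.IsContinuous) (hBm : B.IsMonotone) (hU : IsUniform P U)
    {f g : Payoff P k} (hfg : ConcaveGE f g) : A.TransfersRanking B f g := by
  refine TransfersRanking.congr_eqDist (.of_converges hAc hAm hAs hBc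
    (converges_cellAverage hU f) (converges_cellAverage hU g) fun n => ?_)
    (eqDist_rearrangement hU f) (eqDist_rearrangement hU g)
  have hf := intervalIntegrable_quantile hU f
  have hg := intervalIntegrable_quantile hU g
  have hn : (0 : ℝ) < n + 1 := by positivity
  refine h.transfersRanking_of_prefix hAm hAs hBm (hU.isUniformLabel n)
    (cellAverage_mono hf (monotoneOn_quantile _)) _ ?_ fun m => ?_
  · have htop : Finset.Iic (Fin.last n) = Finset.univ := by
      ext l
      simp [Fin.le_last]
    rw [← htop, sum_Iic_cellAverage hf, sum_Iic_cellAverage hg, Fin.val_last, node_last,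
      ← integral_quantile hU, ← integral_quantile hU, hfg.integral_eq]
  · rw [sum_Iic_cellAverage hf, sum_Iic_cellAverage hg]
    gcongr ?_ * ?_
    exact hfg.integral_quantile_le hU
      ⟨(node_nonneg m).trans_lt (node_lt (Nat.lt_succ_self _)), node_le_one m.2⟩

end NonatomicSpace

theorem RiskPreference.TransfersRegressive.stronglyMoreRiskAverse {S : Type*} [MeasurableSpace S]
    {P : Measure S} [IsProbabilityMeasure P] {k : PayoffClass} {A B : RiskPreference P k}
    (hP : IsAdequate P) (h : A.TransfersRegressive B) (hAc : A.IsContinuous)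
    (hAm : A.IsMonotone) (hAs : A.IsSecular) (hBc : B.IsContinuous) (hBm : B.IsMonotone) :
    B.StronglyMoreRiskAverse A := by
  intro f g ρA ρB hfg hA hB
  refine TransfersRanking.price_le hBm ?_ hA hB
  rcases hP with hP | hP
  · obtain ⟨U, hU, hmap⟩ := hP.exists_uniform
    exact h.transfersRanking_uniform hAc hAm hAs hBc hBm ⟨hU, hmap⟩ hfg
  · obtain ⟨N, κ, hκ, hfac⟩ := hP.exists_label
    obtain ⟨x, hx⟩ := hfac f f.2.1
    obtain ⟨y, hy⟩ := hfac g g.2.1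
    obtain rfl : f = labelPayoff P k hκ.measurable x := Subtype.ext hx
    obtain rfl : g = labelPayoff P k hκ.measurable y := Subtype.ext hy
    exact h.transfersRanking_label hAm hAs hBm hκ hfg

/-! ### Inclusions between the classes of insurance. -/

section Insurance

variable {S : Type*} [MeasurableSpace S] {P : Measure S} [IsProbabilityMeasure P]
  {k : PayoffClass} {A B : RiskPreference P k}

theorem RiskPreference.MorePropenseToInsurance.mono {hAs : A.IsSecular} {hBs : B.IsSecular}
    {I J : Payoff P k → Set (Payoff P k)} (h : B.MorePropenseToInsurance A hBs hAs J)
    (hIJ : ∀ w, I w ⊆ J w) : B.MorePropenseToInsurance A hBs hAs I :=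
  fun w f g hgf hf => h w f g hgf (hIJ w hf)

theorem proportional_subset_indemnitySchedule (w : Payoff P k) :
    proportionalInsurance w ⊆ indemnityScheduleInsurance w := by
  rintro f ⟨p, e, -, he, hf⟩
  refine ⟨fun x => (1 - e) * x - p, fun x _ y _ hxy => ?_, fun s => ?_⟩
  · have : 0 ≤ 1 - e := by linarith
    dsimp only
    gcongr
  · rw [hf]
    ring

theorem deductibleLimit_subset_indemnitySchedule (w : Payoff P k) :
    deductibleLimitInsurance w ⊆ indemnityScheduleInsurance w := by
  rintro f ⟨p, d, l, -, hf⟩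
  refine ⟨fun x => min (max (x - d) 0) l - p, fun x _ y _ hxy => ?_, hf⟩
  dsimp only
  gcongr

theorem indemnitySchedule_subset_contingencySchedule (w : Payoff P k) :
    indemnityScheduleInsurance w ⊆ contingencyScheduleInsurance w := by
  rintro f ⟨I, hI, hf⟩
  refine ae_of_all _ fun z hz => ?_
  rw [hf, hf]
  exact hI ⟨z.2, rfl⟩ ⟨z.1, rfl⟩ (le_of_lt hz)

end Insurance

end InsuranceRisk

theorem mainTheorem4 {S : Type*} [MeasurableSpace S] (P : Measure S) [IsProbabilityMeasure P]
    (hP : InsuranceRisk.IsAdequate P) (k : InsuranceRisk.PayoffClass)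
    (A B : InsuranceRisk.RiskPreference P k)
    (hAc : A.IsContinuous) (hAm : A.IsMonotone) (hAs : A.IsSecular)
    (hBc : B.IsContinuous) (hBm : B.IsMonotone) (hBs : B.IsSecular) :
    List.TFAE [
      B.StronglyMoreRiskAverse A,
      B.MorePropenseToInsurance A hBs hAs InsuranceRisk.proportionalInsurance,
      B.MorePropenseToInsurance A hBs hAs InsuranceRisk.deductibleLimitInsurance,
      B.MorePropenseToInsurance A hBs hAs InsuranceRisk.indemnityScheduleInsurance,
      B.MorePropenseToInsurance A hBs hAs InsuranceRisk.contingencyScheduleInsurance,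
      B.MorePropenseToHedging A hBs hAs] := by
  tfae_have 1 → 6 := fun h w f g _ hfg =>
    h _ _ _ _ hfg.concaveGE (A.price_spec hAs _ _) (B.price_spec hBs _ _)
  tfae_have 6 → 5 := fun h w f g hgf hf =>
    h w f g hgf (InsuranceRisk.betterHedge_of_contingencySchedule hgf.symm hf)
  tfae_have 5 → 4 := fun h =>
    h.mono InsuranceRisk.indemnitySchedule_subset_contingencySchedule
  tfae_have 4 → 3 := fun h => h.mono InsuranceRisk.deductibleLimit_subset_indemnitySchedule
  tfae_have 4 → 2 := fun h => h.mono InsuranceRisk.proportional_subset_indemnitySchedule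
  tfae_have 3 → 1 := fun h =>
    (h.transfersRegressive_of_deductibleLimit hAm hBm).stronglyMoreRiskAverse
      hP hAc hAm hAs hBc hBm
  tfae_have 2 → 1 := fun h =>
    (h.transfersRegressive_of_proportional hAc hAm hBc hBm).stronglyMoreRiskAverse
      hP hAc hAm hAs hBc hBm
  tfae_finish
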